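/- **Setting.** Let $\mathcal X$ be a measurable space of arms. A *bandit environment* $M$ on $\mathcal X$ assigns to every arm $x$ (measurably) a probability distribution $M_x$ supported in $[0,1]$; write $f(x)=\int y\,dM_x(y)$ and $f^*=\sup_{x} f(x)$. When arms $X_1,\dots,X_n$ are played (rewards $Y_t\sim M_{X_t}$, drawn independently of the past given $X_t$), the (pseudo-)regret is $R_n=nf^*-\sum_{t=1}^n f(X_t)$. A *dissimilarity* is a map $\ell:\mathcal X^2\to[0,\infty)$ with $\ell(x,x)=0$; put $\mathrm{diam}(A)=\sup_{x,y\in A}\ell(x,y)$ and $\mathcal B(x,\epsilon)=\{y:\ell(x,y)<\epsilon\}$. The packing number $\mathcal N(\mathcal X,\ell,\epsilon)$ is the largest number of pairwise disjoint balls $\mathcal B(x,\epsilon)$ in $\mathcal X$, and the *$\ell$-packing dimension* of $\mathcal X$ is $\limsup_{\epsilon\to0}\ln\mathcal N(\mathcal X,\ell,\epsilon)/\ln(\epsilon^{-1})$. Let $\mathcal F_{\mathcal X,\ell}$ be the class of all environments with weakly Lipschitz mean payoff, i.e. $f^*-f(y)\le f^*-f(x)+\max\{f^*-f(x),\ell(x,y)\}$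 for all $x,y\in\mathcal X$. **Algorithm.** A *tree of coverings* is a family of measurable sets $\mathcal P_{h,i}\subset\mathcal X$ ($h\ge0$, $1\le i\le2^h$) with $\mathcal P_{0,1}=\mathcal X$ and $\mathcal P_{h,i}=\mathcal P_{h+1,2i-1}\cup\mathcal P_{h+1,2i}$; the node $(h,i)$ has children $(h+1,2i-1)$ and $(h+1,2i)$. HOO with parameters $\nu_1>0$, $\rho\in(0,1)$ and $(\mathcal P_{h,i})$ keeps the tree $\mathcal T_n$ formed by the root $(0,1)$ and the nodes played in the first $n$ rounds. Let $T_{h,i}(n)$ be the number of rounds $t\le n$ in which a descendant of $(h,i)$ (possibly itself) was played and $\hat\mu_{h,i}(n)$ the average reward in these rounds; let $U_{h,i}(n)=\hat\mu_{h,i}(n)+\sqrt{2\ln n/T_{h,i}(n)}+\nu_1\rho^h$ if $T_{h,i}(n)>0$ and $U_{h,i}(n)=+\infty$ otherwise; let $B_{h,i}(n)=\min\{U_{h,i}(n),\max\{B_{h+1,2i-1}(n),B_{h+1,2i}(n)\}\}$ if $(h,i)\in\mathcal T_n$ and $B_{h,i}(n)=+\infty$ otherwise. In round $n+1$, HOO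 starts at the root and moves, as long as the current node is in $\mathcal T_n$, to a child with the larger value $B(n)$ (ties broken arbitrarily, possibly at random); it plays the node $(H,I)\notin\mathcal T_n$ so reached, with an arbitrary (possibly random) arm of $\mathcal P_{H,I}$. Both choices may depend on the past only. **Assumption A1** (with constant $\nu_2>0$). For all $h\ge0$ and $1\le i\le2^h$: $\mathrm{diam}(\mathcal P_{h,i})\le\nu_1\rho^h$; there is $x^\circ_{h,i}\in\mathcal P_{h,i}$ with $\mathcal B(x^\circ_{h,i},\nu_2\rho^h)\subset\mathcal P_{h,i}$; and for each $h$ the balls $\mathcal B(x^\circ_{h,i},\nu_2\rho^h)$, $1\le i\le2^h$, are pairwise disjoint. **Theorem.** Suppose that $\mathcal X$ has finite $\ell$-packing dimension $D$, and let $\nu_1,\nu_2>0$ and $\rho\in(0,1)$. Then for every $D'>D$ there is a constant $\gamma$, depending only on $\mathcal X,\ell,\nu_1,\rho,\nu_2,D'$, such that for every tree of coverings satisfying A1, every version of HOO with these parameters, and all $n\ge2$, $$\sup_{M\in\mathcal F_{\mathcal X,\ell}}\mathbb E_M\bigl[R_n(\mathrm{HOO})\bigr]\le\gamma\,n^{(D'+1)/(D'+2)}(\ln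 n)^{1/(D'+2)}.$$ -/

import Mathlib

open MeasureTheory ProbabilityTheory Filter Topology
open scoped ENNReal

noncomputable section

namespace XArmedBandit

/-! ### Dissimilarities, balls, packing numbers -/

/-- A dissimilarity over `X`: a non-negative function of two points, vanishing on the diagonal.
Neither symmetry nor the triangle inequality is required. -/
structure Dissimilarity (X : Type*) where
  toFun : X → X → ℝ
  nonneg : ∀ x y, 0 ≤ toFun x y
  self : ∀ x, toFun x x = 0

instance (X : Type*) : CoeFun (Dissimilarity X) (fun _ => X → X → ℝ) := ⟨Dissimilarity.toFun⟩

section Packing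

variable {X : Type*}

/-- The diameter of a set, with value `∞` when the dissimilarity is unbounded on it. -/
def diam (l : Dissimilarity X) (A : Set X) : ℝ≥0∞ :=
  ⨆ x ∈ A, ⨆ y ∈ A, ENNReal.ofReal (l x y)

/-- The open ball with center `x` and radius `ε`. -/
def ball (l : Dissimilarity X) (x : X) (ε : ℝ) : Set X := {y | l x y < ε}

/-- The `ε`-packing number of `A`: the largest number (possibly `∞`) of pairwise disjoint open
balls of radius `ε` contained in `A`. For `ε > 0` a ball contains its center, so that disjoint
balls have distinct centers and counting balls amounts to counting centers. -/
def packingNumber (l : Dissimilarity X) (A : Set X) (ε : ℝ) : ℕ∞ :=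
  ⨆ (s : Finset X) (_ : (∀ x ∈ s, ball l x ε ⊆ A) ∧
    (s : Set X).PairwiseDisjoint fun x => ball l x ε), (s.card : ℕ∞)

/-- The packing dimension of a set, an extended real number. -/
def packingDimension (l : Dissimilarity X) (A : Set X) : EReal :=
  limsup (fun ε : ℝ => ENNReal.log ((packingNumber l A ε : ℕ∞) : ℝ≥0∞) /
    ((Real.log ε⁻¹ : ℝ) : EReal)) (𝓝[>] (0 : ℝ))

end Packing

/-! ### The infinite binary tree and trees of coverings -/

/-- The node at depth `h` with index `i` (where `1 ≤ i ≤ 2 ^ h`) is the pair `(h, i)`. -/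
abbrev Node : Type := ℕ × ℕ

def Node.IsValid (v : Node) : Prop := 1 ≤ v.2 ∧ v.2 ≤ 2 ^ v.1

def root : Node := (0, 1)

def leftChild (v : Node) : Node := (v.1 + 1, 2 * v.2 - 1)

def rightChild (v : Node) : Node := (v.1 + 1, 2 * v.2)

/-- `IsDescendant v w`: the node `w` belongs to the set `C(v)` of descendants of `v`
(`v` itself included). -/
inductive IsDescendant (v : Node) : Node → Prop
  | refl : IsDescendant v v
  | left (w : Node) : IsDescendant v w → IsDescendant v (leftChild w)
  | right (w : Node) : IsDescendant v w → IsDescendant v (rightChild w)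

/-- A tree of coverings of `X`. -/
structure TreeOfCoverings (X : Type*) [MeasurableSpace X] where
  region : Node → Set X
  measurableSet_region : ∀ v : Node, v.IsValid → MeasurableSet (region v)
  region_root : region root = Set.univ
  region_eq_union : ∀ v : Node, v.IsValid →
    region v = region (leftChild v) ∪ region (rightChild v)

/-- Assumption A1, for the parameters `ν₁`, `ρ` and the tree of coverings `P` of the algorithm, the
dissimilarity `l` and the constant `ν₂`. -/
def ShrinkingRegions {X : Type*} [MeasurableSpace X] (l : Dissimilarity X) (ν₁ ρ ν₂ : ℝ)
    (P : TreeOfCoverings X) : Prop :=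
  (∀ v : Node, v.IsValid → diam l (P.region v) ≤ ENNReal.ofReal (ν₁ * ρ ^ v.1)) ∧
  ∃ c : Node → X,
    (∀ v : Node, v.IsValid →
      c v ∈ P.region v ∧ ball l (c v) (ν₂ * ρ ^ v.1) ⊆ P.region v) ∧
    ∀ h i j : ℕ, 1 ≤ i → i < j → j ≤ 2 ^ h →
      Disjoint (ball l (c (h, i)) (ν₂ * ρ ^ h)) (ball l (c (h, j)) (ν₂ * ρ ^ h))

/-! ### Bandit environments -/

/-- A bandit environment on `X`: to every arm `x` a probability distribution on `ℝ`, supported in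
`[0, 1]`, that depends measurably on `x`. -/
structure Environment (X : Type*) [MeasurableSpace X] where
  reward : Kernel X ℝ
  isMarkov : IsMarkovKernel reward
  mem_Icc : ∀ x, ∀ᵐ y ∂(reward x), y ∈ Set.Icc (0 : ℝ) 1

attribute [instance] Environment.isMarkov

section Env

variable {X : Type*} [MeasurableSpace X]

/-- The mean-payoff function `f`. -/
def Environment.mean (M : Environment X) (x : X) : ℝ := ∫ y, y ∂(M.reward x)

/-- `f* = sup f`. -/
def Environment.best (M : Environment X) : ℝ := ⨆ x, M.mean x

/-- Assumption A2: the mean-payoff function is weakly Lipschitz. -/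
def Environment.IsWeaklyLipschitz (M : Environment X) (l : Dissimilarity X) : Prop :=
  ∀ x y, M.best - M.mean y ≤ M.best - M.mean x + max (M.best - M.mean x) (l x y)

/-- The class of all environments with a weakly Lipschitz mean-payoff function. -/
def weaklyLipschitzEnvironments (l : Dissimilarity X) : Set (Environment X) :=
  {M | M.IsWeaklyLipschitz l}

end Env

/-! ### Statistics of the HOO algorithm -/

/-- What is recorded in `n` rounds: for each round the node played, the arm played, and the reward.
The entry with index `t : Fin n` belongs to round `t + 1`. -/
abbrev History (X : Type*) (n : ℕ) : Type _ := Fin n → Node × X × ℝ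

section Statistics

variable {X : Type*} {n : ℕ}

/-- The tree `T_n`: the root, and the nodes played in the first `n` rounds. -/
def tree (H : History X n) : Finset Node :=
  insert root (Finset.univ.image fun t => (H t).1)

open Classical in
/-- The rounds in which a descendant of `v` was played. -/
def visits (H : History X n) (v : Node) : Finset (Fin n) :=
  Finset.univ.filter fun t => IsDescendant v (H t).1

/-- `T_v(n)`. -/
def visitCount (H : History X n) (v : Node) : ℕ := (visits H v).card

/-- The empirical average of the rewards received in the rounds counted by `T_v(n)`. -/
def empMean (H : History X n) (v : Node) : ℝ :=
  (∑ t ∈ visits H v, (H t).2.2) / (visitCount H v : ℝ)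

/-- `U_v(n)`. -/
def Uvalue (ν₁ ρ : ℝ) (H : History X n) (v : Node) : EReal :=
  if 0 < visitCount H v then
    ((empMean H v + √(2 * Real.log n / (visitCount H v : ℝ)) + ν₁ * ρ ^ v.1 : ℝ) : EReal)
  else ⊤

/-- The backward recursion for the `B`-values, run through `k` levels of the tree. -/
def BvalueAux (ν₁ ρ : ℝ) (H : History X n) : ℕ → Node → EReal
  | 0, _ => ⊤
  | k + 1, v =>
    if v ∈ tree H then
      min (Uvalue ν₁ ρ H v)
        (max (BvalueAux ν₁ ρ H k (leftChild v)) (BvalueAux ν₁ ρ H k (rightChild v)))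
    else ⊤

/-- `B_v(n)`. The tree has at most `n + 1` nodes, so that `n + 1` levels exhaust it; see
`Bvalue_eq` for the recursion that characterizes the `B`-values. -/
def Bvalue (ν₁ ρ : ℝ) (H : History X n) (v : Node) : EReal := BvalueAux ν₁ ρ H (n + 1) v

theorem BvalueAux_succ_eq (ν₁ ρ : ℝ) (H : History X n) (k : ℕ) :
    ∀ v : Node, ((tree H).filter fun w => v.1 ≤ w.1).card ≤ k →
      BvalueAux ν₁ ρ H (k + 1) v = BvalueAux ν₁ ρ H k v := by
  induction k with
  | zero =>
    intro v hv
    have hv' : v ∉ tree H := by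
      intro hmem
      have : v ∈ (tree H).filter fun w => v.1 ≤ w.1 := by simp [hmem]
      have := Finset.card_pos.mpr ⟨v, this⟩
      omega
    simp [BvalueAux, hv']
  | succ k ih =>
    intro v hv
    by_cases hmem : v ∈ tree H
    · have hk : ∀ (j : ℕ), BvalueAux ν₁ ρ H (j + 1) v = min (Uvalue ν₁ ρ H v)
          (max (BvalueAux ν₁ ρ H j (leftChild v)) (BvalueAux ν₁ ρ H j (rightChild v))) := by
        intro j
        simp only [BvalueAux, if_pos hmem]
      have key : ∀ c : Node, c.1 = v.1 + 1 →
          ((tree H).filter fun w => c.1 ≤ w.1).card ≤ k := by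
        intro c hc
        have hlt : ((tree H).filter fun w => c.1 ≤ w.1).card
            < ((tree H).filter fun w => v.1 ≤ w.1).card := by
          apply Finset.card_lt_card
          refine ⟨fun w hw => ?_, fun hsub => ?_⟩
          · simp only [Finset.mem_filter] at hw ⊢
            exact ⟨hw.1, by omega⟩
          · have h1 : v ∈ (tree H).filter fun w => v.1 ≤ w.1 := by simp [hmem]
            have h2 := hsub h1
            simp only [Finset.mem_filter] at h2
            omega
        omega
      rw [hk, hk, ih (leftChild v) (key _ rfl), ih (rightChild v) (key _ rfl)]
    · simp [BvalueAux, hmem]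

/-- The recursion defining the `B`-values. -/
theorem Bvalue_eq (ν₁ ρ : ℝ) (H : History X n) (v : Node) :
    Bvalue ν₁ ρ H v =
      if v ∈ tree H then
        min (Uvalue ν₁ ρ H v)
          (max (Bvalue ν₁ ρ H (leftChild v)) (Bvalue ν₁ ρ H (rightChild v)))
      else ⊤ := by
  have hcard : ((tree H).filter fun w => v.1 ≤ w.1).card ≤ n + 1 := by
    refine (Finset.card_filter_le _ _).trans ((Finset.card_insert_le _ _).trans ?_)
    have := (Finset.card_image_le (s := (Finset.univ : Finset (Fin n)))
      (f := fun t => (H t).1))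
    simp only [Finset.card_univ, Fintype.card_fin] at this
    omega
  unfold Bvalue
  rw [← BvalueAux_succ_eq ν₁ ρ H (n + 1) v hcard]
  rfl

/-- The nodes that can be reached in round `n + 1` by starting at the root and moving, as long as
the current node belongs to `T_n`, to a child with highest `B`-value (ties may be broken either
way). -/
inductive IsReached (ν₁ ρ : ℝ) (H : History X n) : Node → Prop
  | root : IsReached ν₁ ρ H root
  | left (v : Node) : IsReached ν₁ ρ H v → v ∈ tree H →
      Bvalue ν₁ ρ H (rightChild v) ≤ Bvalue ν₁ ρ H (leftChild v) →
      IsReached ν₁ ρ H (leftChild v)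
  | right (v : Node) : IsReached ν₁ ρ H v → v ∈ tree H →
      Bvalue ν₁ ρ H (leftChild v) ≤ Bvalue ν₁ ρ H (rightChild v) →
      IsReached ν₁ ρ H (rightChild v)

/-- The traversal stops at `v`: the node `v` may be the one played in round `n + 1`. -/
def IsSelected (ν₁ ρ : ℝ) (H : History X n) (v : Node) : Prop :=
  IsReached ν₁ ρ H v ∧ v ∉ tree H

end Statistics

/-! ### Strategies, the HOO strategies, and their regret -/

/-- A (randomized) bandit strategy that keeps track of nodes: in round `n + 1` it draws a node and
an arm from a distribution that depends measurably on the history of the first `n` rounds. -/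
structure Strategy (X : Type*) [MeasurableSpace X] where
  choice : (n : ℕ) → Kernel (History X n) (Node × X)
  isMarkov : ∀ n, IsMarkovKernel (choice n)

attribute [instance] Strategy.isMarkov

section Regret

variable {X : Type*} [MeasurableSpace X]

/-- `φ` is a version of HOO with parameters `ν₁`, `ρ` and `P`: in every round it plays an arm in the
region of a node selected by the tree traversal. How ties are broken, and which arm of the region is
played, is left open (both choices may be randomized and may depend on the past). -/
def Strategy.IsHOO (φ : Strategy X) (ν₁ ρ : ℝ) (P : TreeOfCoverings X) : Prop :=
  ∀ (n : ℕ) (H : History X n), ∀ᵐ a ∂(φ.choice n H),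
    IsSelected ν₁ ρ H a.1 ∧ a.2 ∈ P.region a.1

/-- The conditional law of the reward, given the history and the node and arm chosen: it is the
distribution that the environment assigns to the arm. -/
def rewardKernel (M : Environment X) (n : ℕ) : Kernel (History X n × (Node × X)) ℝ :=
  M.reward.comap (fun p => p.2.2) (measurable_snd.comp measurable_snd)

instance (M : Environment X) (n : ℕ) : IsMarkovKernel (rewardKernel M n) := by
  unfold rewardKernel; infer_instance

/-- Appending one round to a history. -/
def extend {n : ℕ} (p : History X n × ((Node × X) × ℝ)) : History X (n + 1) :=
  Fin.snoc (α := fun _ => Node × X × ℝ) p.1 (p.2.1.1, p.2.1.2, p.2.2)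

theorem measurable_extend {n : ℕ} : Measurable (extend (X := X) (n := n)) := by
  refine measurable_pi_lambda _ fun t => ?_
  refine Fin.lastCases ?_ (fun i => ?_) t
  · simp only [extend, Fin.snoc_last]
    fun_prop
  · simp only [extend, Fin.snoc_castSucc]
    fun_prop

/-- The law of the first `n` rounds, when the strategy `φ` plays against the environment `M`. -/
def law (φ : Strategy X) (M : Environment X) : (n : ℕ) → Measure (History X n)
  | 0 => Measure.dirac Fin.elim0
  | n + 1 => ((law φ M n) ⊗ₘ ((φ.choice n) ⊗ₖ (rewardKernel M n))).map extend

instance isProbabilityMeasure_law (φ : Strategy X) (M : Environment X) (n : ℕ) :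
    IsProbabilityMeasure (law φ M n) := by
  induction n with
  | zero => unfold law; infer_instance
  | succ n ih => exact Measure.isProbabilityMeasure_map measurable_extend.aemeasurable

/-- The cumulative (pseudo-)regret `R_n = n f* - ∑ f(X_t)`. -/
def regret (M : Environment X) {n : ℕ} (H : History X n) : ℝ :=
  n * M.best - ∑ t, M.mean (H t).2.1

/-- `E_M[R_n(φ)]`. -/
def expectedRegret (φ : Strategy X) (M : Environment X) (n : ℕ) : ℝ :=
  ∫ H, regret M H ∂(law φ M n)

end Regret

end XArmedBandit

end

/-! Write `Δ(x) = f* - f(x)`. The regret is controlled node by node, and the dimension enters only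
through the crude count `2^h` of the nodes at depth `h`.

Confidence. For a fixed node, the sum of the centered rewards collected below it has an exponential
supermartingale (`lintegral_exp_noise_le_one`). Hence it exceeds the confidence width at time `t`
with probability at most `t⁻³`, even though the number of visits is random
(`law_deviationEvent_le`).

Optimism. Some infinite path from the root consists of nodes whose regions approach `f*`. By the
weak Lipschitz property all arms in such a region have gap at most `ν₁ρ^h`, so without a deviation
the `U`-values along the path are at least `f*`. The traversal maximizes `B`-values, so every tree
node it crosses then has `U ≥ f*` (`IsReached.le_Uvalue`). A node whose region has gaps at least
`2ν₁ρ^h` violates this after about `8 ln n / (ν₁ρ^h)²` visits, and its expected number of visits is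
at most that plus a constant (`Strategy.IsHOO.integral_visitCount_le`).

Decomposition. Fix a depth `K`. Each played arm has gap `O(ν₁ρ^K)`, or comes from a near-optimal
node of depth below `K`, which is played at most once, or lies below a node of depth at most `K`
that is not near-optimal although its parent is (`gap_trichotomy`). Summing over all nodes up to
depth `K` bounds the expected regret by a constant times `nρ^K + ln n · ∑_{h ≤ K} 2^h ρ^(-h)`.

Dimension. By A1 there are `2^h` disjoint balls of radius `ν₂ρ^h`, so the packing dimension forces
`2 ≤ ρ^(-D')` (`ShrinkingRegions.log_two_le`). The sum is then of order `ρ^(-K(D'+1))`, and `ρ^K ≈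
(ln n / n)^(1/(D'+2))` balances the two terms. -/

namespace XArmedBandit

/-! ### Combinatorics of the binary tree -/

section Tree

theorem root_isValid : root.IsValid := by simp [Node.IsValid, root]

theorem Node.IsValid.leftChild {v : Node} (hv : v.IsValid) :
    (XArmedBandit.leftChild v).IsValid := by
  obtain ⟨h1, h2⟩ := hv
  simp only [Node.IsValid, XArmedBandit.leftChild, pow_succ]
  omega

theorem Node.IsValid.rightChild {v : Node} (hv : v.IsValid) :
    (XArmedBandit.rightChild v).IsValid := by
  obtain ⟨h1, h2⟩ := hv
  simp only [Node.IsValid, XArmedBandit.rightChild, pow_succ]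
  omega

theorem leftChild_eq_leftChild {v w : Node} (hv : v.IsValid)
    (h : leftChild w = leftChild v) : w = v := by
  obtain ⟨h1, h2⟩ := hv
  obtain ⟨a, b⟩ := v
  obtain ⟨c, d⟩ := w
  simp only [leftChild, Prod.mk.injEq] at *
  omega

theorem rightChild_eq_rightChild {v w : Node} (h : rightChild w = rightChild v) : w = v := by
  obtain ⟨a, b⟩ := v
  obtain ⟨c, d⟩ := w
  simp only [rightChild, Prod.mk.injEq] at *
  omega

/-- Validity matters: at index `0` truncated subtraction makes the two children of a node coincide.
-/
theorem rightChild_ne_leftChild {v w : Node} (hv : v.IsValid) : rightChild w ≠ leftChild v := by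
  obtain ⟨h1, h2⟩ := hv
  obtain ⟨a, b⟩ := v
  obtain ⟨c, d⟩ := w
  simp only [rightChild, leftChild, Prod.mk.injEq, ne_eq] at *
  omega

theorem leftChild_ne_rightChild {v w : Node} (hv : v.IsValid) : leftChild w ≠ rightChild v := by
  obtain ⟨h1, h2⟩ := hv
  obtain ⟨a, b⟩ := v
  obtain ⟨c, d⟩ := w
  simp only [rightChild, leftChild, Prod.mk.injEq, ne_eq] at *
  omega

theorem leftChild_ne_root (v : Node) : leftChild v ≠ root := by
  simp [leftChild, root]

theorem rightChild_ne_root (v : Node) : rightChild v ≠ root := by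
  simp [rightChild, root]

theorem IsDescendant.depth_le {v w : Node} (h : IsDescendant v w) : v.1 ≤ w.1 := by
  induction h with
  | refl => exact le_rfl
  | left w _ ih => exact ih.trans (Nat.le_succ _)
  | right w _ ih => exact ih.trans (Nat.le_succ _)

theorem IsDescendant.eq_root {v : Node} (h : IsDescendant v root) : v = root := by
  generalize hr : root = r at h
  cases h with
  | refl => rfl
  | left w _ => exact absurd hr.symm (leftChild_ne_root w)
  | right w _ => exact absurd hr.symm (rightChild_ne_root w)

theorem IsDescendant.of_leftChild {v w : Node} (hw : w.IsValid)
    (h : IsDescendant v (leftChild w)) : v = leftChild w ∨ IsDescendant v w := by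
  generalize hr : leftChild w = r at h
  cases h with
  | refl => exact Or.inl rfl
  | left u hu => exact Or.inr (leftChild_eq_leftChild hw hr.symm ▸ hu)
  | right u hu => exact absurd hr.symm (rightChild_ne_leftChild hw)

theorem IsDescendant.of_rightChild {v w : Node} (hw : w.IsValid)
    (h : IsDescendant v (rightChild w)) : v = rightChild w ∨ IsDescendant v w := by
  generalize hr : rightChild w = r at h
  cases h with
  | refl => exact Or.inl rfl
  | left u hu => exact absurd hr.symm (leftChild_ne_rightChild hw)
  | right u hu => exact Or.inr (rightChild_eq_rightChild hr.symm ▸ hu)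

end Tree

/-! ### Optimism: `B`-values along the traversal -/

section Reached

variable {X : Type*} {n : ℕ} {ν₁ ρ : ℝ} {H : History X n}

theorem IsReached.isValid {v : Node} (h : IsReached ν₁ ρ H v) : v.IsValid := by
  induction h with
  | root => exact root_isValid
  | left v _ _ _ ih => exact ih.leftChild
  | right v _ _ _ ih => exact ih.rightChild

theorem IsReached.isDescendant_root {v : Node} (h : IsReached ν₁ ρ H v) :
    IsDescendant XArmedBandit.root v := by
  induction h with
  | root => exact .refl
  | left v _ _ _ ih => exact .left _ ih
  | right v _ _ _ ih => exact .right _ ih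

/-- The traversal descends one edge at a time, so it crosses every ancestor of its endpoint, and it
can only leave a node that is in the tree. -/
theorem IsReached.of_isDescendant {v w : Node} (hw : IsReached ν₁ ρ H w)
    (h : IsDescendant v w) : IsReached ν₁ ρ H v ∧ (v = w ∨ v ∈ tree H) := by
  induction hw with
  | root =>
    obtain rfl := h.eq_root
    exact ⟨.root, Or.inl rfl⟩
  | left w hw hmem hle ih =>
    rcases h.of_leftChild hw.isValid with rfl | h
    · exact ⟨.left w hw hmem hle, Or.inl rfl⟩
    · obtain ⟨h1, h2⟩ := ih h
      exact ⟨h1, Or.inr (h2.elim (fun e => e ▸ hmem) id)⟩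
  | right w hw hmem hle ih =>
    rcases h.of_rightChild hw.isValid with rfl | h
    · exact ⟨.right w hw hmem hle, Or.inl rfl⟩
    · obtain ⟨h1, h2⟩ := ih h
      exact ⟨h1, Or.inr (h2.elim (fun e => e ▸ hmem) id)⟩

theorem IsReached.depth_le {v : Node} (h : IsReached ν₁ ρ H v) {d : ℕ}
    (hd : ∀ w ∈ tree H, w.1 ≤ d) : v.1 ≤ d + 1 := by
  cases h with
  | root => exact Nat.zero_le _
  | left v _ hv _ => exact Nat.succ_le_succ (hd v hv)
  | right v _ hv _ => exact Nat.succ_le_succ (hd v hv)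

/-- Along the traversal the `B`-values do not decrease. -/
theorem IsReached.le_Bvalue {v : Node} (h : IsReached ν₁ ρ H v) {b : EReal}
    (hb : b ≤ Bvalue ν₁ ρ H XArmedBandit.root) : b ≤ Bvalue ν₁ ρ H v := by
  induction h with
  | root => exact hb
  | left v _ hmem hle ih =>
    rw [Bvalue_eq, if_pos hmem, max_eq_left hle] at ih
    exact ih.trans (min_le_right _ _)
  | right v _ hmem hle ih =>
    rw [Bvalue_eq, if_pos hmem, max_eq_right hle] at ih
    exact ih.trans (min_le_right _ _)

/-- The recursion takes a minimum with `U` and a maximum over the children, so one child on the path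
suffices. Where the recursion is cut off, or the path leaves the tree, the value is `⊤`. -/
theorem le_BvalueAux_of_path {w : ℕ → Node}
    (hw : ∀ j, w (j + 1) = leftChild (w j) ∨ w (j + 1) = rightChild (w j)) {b : EReal}
    (hb : ∀ j, b ≤ Uvalue ν₁ ρ H (w j)) (k j : ℕ) : b ≤ BvalueAux ν₁ ρ H k (w j) := by
  induction k generalizing j with
  | zero => exact le_top
  | succ k ih =>
    rw [BvalueAux]
    split_ifs
    · refine le_min (hb j) ?_
      rcases hw j with h | h
      · exact (ih (j + 1)).trans (h ▸ le_max_left _ _)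
      · exact (ih (j + 1)).trans (h ▸ le_max_right _ _)
    · exact le_top

/-- If the `U`-values along an infinite path from the root are at least `b`, then so are the
`U`-values of all nodes of the tree through which the traversal passes. -/
theorem IsReached.le_Uvalue {v : Node} (h : IsReached ν₁ ρ H v) (hv : v ∈ tree H) {w : ℕ → Node}
    (hw₀ : w 0 = XArmedBandit.root)
    (hw : ∀ j, w (j + 1) = leftChild (w j) ∨ w (j + 1) = rightChild (w j)) {b : EReal}
    (hb : ∀ j, b ≤ Uvalue ν₁ ρ H (w j)) : b ≤ Uvalue ν₁ ρ H v := by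
  have h1 := h.le_Bvalue (hw₀ ▸ le_BvalueAux_of_path hw hb (n + 1) 0)
  rw [Bvalue_eq, if_pos hv] at h1
  exact h1.trans (min_le_left _ _)

end Reached

/-! ### Visit counts and accumulated noise -/

section Counts

variable {X : Type*} {n : ℕ}

open Classical in
theorem visitCount_eq_sum (H : History X n) (v : Node) :
    visitCount H v = ∑ t, if IsDescendant v (H t).1 then 1 else 0 := by
  simp [visitCount, visits]

theorem visitCount_le (H : History X n) (v : Node) : visitCount H v ≤ n := by
  simpa [visitCount] using Finset.card_le_univ (visits H v)

variable [MeasurableSpace X]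

/-- The sum of the centered rewards in the rounds in which a descendant of `v` was played. -/
noncomputable def noise (M : Environment X) (H : History X n) (v : Node) : ℝ :=
  ∑ t ∈ visits H v, ((H t).2.2 - M.mean (H t).2.1)

open Classical in
theorem noise_eq_sum (M : Environment X) (H : History X n) (v : Node) :
    noise M H v = ∑ t, if IsDescendant v (H t).1 then (H t).2.2 - M.mean (H t).2.1 else 0 := by
  rw [noise, visits, Finset.sum_filter]

omit [MeasurableSpace X] in
open Classical in
theorem visitCount_extend (H : History X n) (a : Node × X) (y : ℝ) (v : Node) :
    visitCount (extend (H, a, y)) v = visitCount H v + if IsDescendant v a.1 then 1 else 0 := by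
  rw [visitCount_eq_sum, visitCount_eq_sum, Fin.sum_univ_castSucc]
  simp [extend]

open Classical in
theorem noise_extend (M : Environment X) (H : History X n) (a : Node × X) (y : ℝ) (v : Node) :
    noise M (extend (H, a, y)) v
      = noise M H v + if IsDescendant v a.1 then y - M.mean a.2 else 0 := by
  rw [noise_eq_sum, noise_eq_sum, Fin.sum_univ_castSucc]
  simp [extend]

/-- The product form also covers unvisited nodes, where both sides vanish. -/
theorem visitCount_mul_empMean (M : Environment X) {H : History X n} {v : Node} :
    visitCount H v * empMean H v
      = noise M H v + ∑ t ∈ visits H v, M.mean (H t).2.1 := by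
  rw [noise, ← Finset.sum_add_distrib]
  simp only [sub_add_cancel]
  rcases Nat.eq_zero_or_pos (visitCount H v) with h0 | h0
  · have : visits H v = ∅ := Finset.card_eq_zero.mp h0
    simp [h0, this]
  · rw [empMean, mul_div_cancel₀]
    exact_mod_cast h0.ne'

end Counts

/-! ### Measurability of the statistics -/

section Measurability

variable {X : Type*} [MeasurableSpace X] {n : ℕ}

theorem measurableSet_nodes (p : (Fin n → Node) → Prop) :
    MeasurableSet {H : History X n | p fun t => (H t).1} := by
  have h : Measurable fun (H : History X n) (t : Fin n) => (H t).1 := by fun_prop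
  exact h (MeasurableSet.of_discrete (s := {N | p N}))

theorem Environment.measurable_mean (M : Environment X) : Measurable M.mean :=
  (StronglyMeasurable.integral_kernel (κ := M.reward) (f := fun y : ℝ => y)
    measurable_id.stronglyMeasurable).measurable

theorem measurable_visitCount (v : Node) :
    Measurable fun H : History X n => visitCount H v := by
  classical
  simp only [visitCount_eq_sum]
  refine Finset.measurable_fun_sum _ fun t _ => ?_
  exact Measurable.ite (measurableSet_nodes fun N => IsDescendant v (N t))
    measurable_const measurable_const

theorem measurable_noise (M : Environment X) (v : Node) :
    Measurable fun H : History X n => noise M H v := by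
  classical
  simp only [noise_eq_sum]
  refine Finset.measurable_fun_sum _ fun t _ => ?_
  refine Measurable.ite (measurableSet_nodes fun N => IsDescendant v (N t)) ?_ measurable_const
  have := M.measurable_mean
  fun_prop

end Measurability

/-! ### One-step disintegration of the law -/

section Law

variable {X : Type*} [MeasurableSpace X] {n : ℕ}

theorem lintegral_law_succ (φ : Strategy X) (M : Environment X) {F : History X (n + 1) → ℝ≥0∞}
    (hF : Measurable F) :
    ∫⁻ H, F H ∂(law φ M (n + 1)) = ∫⁻ H, ∫⁻ a, ∫⁻ y, F (extend (H, a, y)) ∂(M.reward a.2)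
      ∂(φ.choice n H) ∂(law φ M n) := by
  rw [law, lintegral_map hF measurable_extend,
    Measure.lintegral_compProd (f := fun p => F (extend p)) (hF.comp measurable_extend)]
  refine lintegral_congr fun H => ?_
  rw [Kernel.lintegral_compProd (f := fun b => F (extend (H, b))) _ _ _
    ((hF.comp measurable_extend).comp measurable_prodMk_left)]
  rfl

theorem ae_law_succ {φ : Strategy X} {M : Environment X} {p : History X (n + 1) → Prop}
    (hp : MeasurableSet {H | p H})
    (h : ∀ᵐ H ∂(law φ M n), ∀ᵐ a ∂(φ.choice n H), ∀ y, p (extend (H, a, y))) :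
    ∀ᵐ H ∂(law φ M (n + 1)), p H := by
  have hc : MeasurableSet {H | ¬ p H} := hp.compl
  rw [ae_iff, ← lintegral_indicator_one hc, lintegral_law_succ φ M (measurable_one.indicator hc)]
  refine (lintegral_congr_ae (g := fun _ => 0) ?_).trans lintegral_zero
  filter_upwards [h] with H hH
  refine (lintegral_congr_ae (g := fun _ => 0) ?_).trans lintegral_zero
  filter_upwards [hH] with a ha
  simp [ha]

end Law

/-! ### Mean payoff and Hoeffding's lemma -/

section Mean

variable {X : Type*} [MeasurableSpace X] (M : Environment X)

theorem Environment.mean_le_one (x : X) : M.mean x ≤ 1 := by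
  have := integral_mono_of_nonneg (μ := M.reward x) (f := fun y : ℝ => y) (g := fun _ => (1 : ℝ))
    ((M.mem_Icc x).mono fun _ h => h.1) (integrable_const 1) ((M.mem_Icc x).mono fun _ h => h.2)
  rw [integral_const, probReal_univ, one_smul] at this
  exact this

theorem Environment.mean_le_best (x : X) : M.mean x ≤ M.best :=
  le_ciSup (f := M.mean) ⟨1, by rintro _ ⟨x, rfl⟩; exact M.mean_le_one x⟩ x

/-- Hoeffding's lemma for the rewards. -/
theorem Environment.lintegral_exp_le_one (x : X) (r : ℝ) :
    ∫⁻ y, ENNReal.ofReal (Real.exp (r * (y - M.mean x) - r ^ 2 / 8)) ∂(M.reward x) ≤ 1 := by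
  have h := hasSubgaussianMGF_of_mem_Icc (μ := M.reward x) (X := fun y : ℝ => y)
    aemeasurable_id (M.mem_Icc x)
  have hint := h.integrable_exp_mul r
  have hle := h.mgf_le r
  have hsplit : ∀ y : ℝ, Real.exp (r * (y - M.mean x) - r ^ 2 / 8)
      = Real.exp (-(r ^ 2 / 8)) * Real.exp (r * (y - ∫ z, z ∂(M.reward x))) := by
    intro y
    rw [← Real.exp_add, Environment.mean]
    congr 1
    ring
  simp_rw [hsplit]
  rw [← ofReal_integral_eq_lintegral_ofReal (hint.const_mul _)
    (Eventually.of_forall fun y => by positivity), integral_const_mul]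
  rw [mgf] at hle
  rw [ENNReal.ofReal_le_one]
  calc _ ≤ Real.exp (-(r ^ 2 / 8)) * _ := mul_le_mul_of_nonneg_left hle (Real.exp_pos _).le
    _ = 1 := by
      rw [← Real.exp_add, Real.exp_eq_one_iff]
      simp
      ring

end Mean

/-! ### Concentration at a fixed node -/

section Concentration

variable {X : Type*} [MeasurableSpace X]

/-- Supermartingale argument: given the past and the chosen arm, a round outside the descendants of
`v` changes nothing, and any other round multiplies by a factor of mean at most `1` by Hoeffding's
lemma. Compensating with the actual visit count avoids stopping times. -/
theorem lintegral_exp_noise_le_one (φ : Strategy X) (M : Environment X) (v : Node) (r : ℝ)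
    (n : ℕ) :
    ∫⁻ H, ENNReal.ofReal (Real.exp (r * noise M H v - r ^ 2 / 8 * visitCount H v))
      ∂(law φ M n) ≤ 1 := by
  classical
  induction n with
  | zero =>
    refine (lintegral_mono (g := fun _ => 1) fun H => ?_).trans (by simp)
    simp [noise_eq_sum, visitCount_eq_sum]
  | succ n ih =>
    have hmeas : ∀ m, Measurable fun H : History X m =>
        ENNReal.ofReal (Real.exp (r * noise M H v - r ^ 2 / 8 * visitCount H v)) := by
      intro m
      have h1 := measurable_noise (n := m) M v
      have h2 : Measurable fun H : History X m => (visitCount H v : ℝ) :=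
        measurable_from_top.comp (measurable_visitCount v)
      fun_prop
    rw [lintegral_law_succ φ M (hmeas _)]
    refine (lintegral_mono fun H => ?_).trans ih
    refine (lintegral_mono (g := fun _ => ENNReal.ofReal
      (Real.exp (r * noise M H v - r ^ 2 / 8 * visitCount H v))) fun a => ?_).trans (by simp)
    simp only [noise_extend, visitCount_extend]
    by_cases hd : IsDescendant v a.1
    · simp only [hd, if_true]
      have hsplit : ∀ y : ℝ, ENNReal.ofReal (Real.exp (r * (noise M H v + (y - M.mean a.2))
          - r ^ 2 / 8 * ((visitCount H v + 1 : ℕ) : ℝ)))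
          = ENNReal.ofReal (Real.exp (r * noise M H v - r ^ 2 / 8 * visitCount H v))
            * ENNReal.ofReal (Real.exp (r * (y - M.mean a.2) - r ^ 2 / 8)) := by
        intro y
        rw [← ENNReal.ofReal_mul (Real.exp_pos _).le, ← Real.exp_add]
        congr 2
        push_cast
        ring
      simp_rw [hsplit]
      rw [lintegral_const_mul' _ _ ENNReal.ofReal_ne_top]
      exact mul_le_of_le_one_right' (M.lintegral_exp_le_one a.2 r)
    · simp [hd]

/-- The event that the noise accumulated at `v` is, in the direction `σ`, at least as large as the
confidence bound. -/
def deviationEvent (M : Environment X) (n : ℕ) (σ : ℝ) (v : Node) : Set (History X n) :=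
  {H | 1 ≤ visitCount H v ∧ √(2 * visitCount H v * Real.log n) ≤ σ * noise M H v}

theorem measurableSet_deviationEvent (M : Environment X) (n : ℕ) (σ : ℝ) (v : Node) :
    MeasurableSet (deviationEvent M n σ v) := by
  have h1 := measurable_noise (n := n) M v
  have h2 : Measurable fun H : History X n => (visitCount H v : ℝ) :=
    measurable_from_top.comp (measurable_visitCount v)
  exact (measurableSet_le measurable_const (measurable_visitCount v)).inter
    (measurableSet_le (f := fun H : History X n => √(2 * visitCount H v * Real.log n))
      (g := fun H => σ * noise M H v) (by fun_prop) (by fun_prop))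

/-- The visit count is random, so Markov's inequality is applied for each of its `n` possible
positive values `s`; each contributes `n⁻⁴`. -/
theorem law_deviationEvent_le (φ : Strategy X) (M : Environment X) {n : ℕ} (hn : 1 ≤ n) {σ : ℝ}
    (hσ : σ ^ 2 = 1) (v : Node) :
    law φ M n (deviationEvent M n σ v) ≤ ENNReal.ofReal (1 / (n : ℝ) ^ 3) := by
  have hn0 : (0 : ℝ) < n := by exact_mod_cast hn
  have hlog : 0 ≤ Real.log n := Real.log_nonneg (by exact_mod_cast hn)
  have hfix : ∀ s ∈ Finset.Icc 1 n, law φ M n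
      {H | visitCount H v = s ∧ √(2 * s * Real.log n) ≤ σ * noise M H v}
        ≤ ENNReal.ofReal (1 / (n : ℝ) ^ 4) := by
    intro s hs
    have hs0 : (0 : ℝ) < s := by exact_mod_cast (Finset.mem_Icc.mp hs).1
    set a := √(2 * s * Real.log n) with ha
    have ha0 : 0 ≤ a := Real.sqrt_nonneg _
    have ha2 : a ^ 2 = 2 * s * Real.log n := Real.sq_sqrt (by positivity)
    -- For `σ = 1` this maximizes `r * a - r ^ 2 / 8 * s`; the maximum is `2 * a ^ 2 / s = 4 * log
    -- n`. The sign `σ` selects the tail.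
    set r := 4 * σ * a / s with hr
    calc law φ M n {H | visitCount H v = s ∧ a ≤ σ * noise M H v}
        ≤ law φ M n {H | ENNReal.ofReal ((n : ℝ) ^ 4) ≤
          ENNReal.ofReal (Real.exp (r * noise M H v - r ^ 2 / 8 * visitCount H v))} := by
          refine measure_mono ?_
          rintro H ⟨hT, hS⟩
          refine ENNReal.ofReal_le_ofReal ?_
          rw [hT, ← Real.exp_log (show 0 < (n : ℝ) ^ 4 by positivity), Real.exp_le_exp,
            Real.log_pow]
          have h1 : r * noise M H v = 4 * (a * (σ * noise M H v)) / s := by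
            rw [hr]; ring
          have h2 : r ^ 2 / 8 * s = 4 * Real.log n := by
            have : r ^ 2 / 8 * s = 2 * σ ^ 2 * a ^ 2 / s := by
              rw [hr]; field_simp; ring
            rw [this, hσ, ha2]; field_simp; ring
          have h3 : 8 * Real.log n ≤ r * noise M H v := by
            rw [h1, le_div_iff₀ hs0]
            nlinarith [mul_le_mul_of_nonneg_left hS ha0]
          rw [h2]
          push_cast
          linarith
      _ ≤ (∫⁻ H, ENNReal.ofReal (Real.exp (r * noise M H v - r ^ 2 / 8 * visitCount H v))
          ∂(law φ M n)) / ENNReal.ofReal ((n : ℝ) ^ 4) := by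
          have h1 := measurable_noise (n := n) M v
          have h2 : Measurable fun H : History X n => (visitCount H v : ℝ) :=
            measurable_from_top.comp (measurable_visitCount v)
          refine meas_ge_le_lintegral_div (by fun_prop) ?_ ENNReal.ofReal_ne_top
          exact (ENNReal.ofReal_pos.mpr (pow_pos hn0 4)).ne'
      _ ≤ 1 / ENNReal.ofReal ((n : ℝ) ^ 4) := by
          gcongr
          exact lintegral_exp_noise_le_one φ M v r n
      _ = ENNReal.ofReal (1 / (n : ℝ) ^ 4) := by
          rw [ENNReal.ofReal_div_of_pos (by positivity), ENNReal.ofReal_one]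
  calc law φ M n (deviationEvent M n σ v)
      ≤ law φ M n (⋃ s ∈ Finset.Icc 1 n,
        {H | visitCount H v = s ∧ √(2 * s * Real.log n) ≤ σ * noise M H v}) := by
        refine measure_mono ?_
        rintro H ⟨h1, h2⟩
        simp only [Set.mem_iUnion]
        exact ⟨visitCount H v, Finset.mem_Icc.mpr ⟨h1, visitCount_le H v⟩, rfl, h2⟩
    _ ≤ ∑ s ∈ Finset.Icc 1 n, ENNReal.ofReal (1 / (n : ℝ) ^ 4) :=
        (measure_biUnion_finset_le _ _).trans (Finset.sum_le_sum hfix)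
    _ = ENNReal.ofReal (1 / (n : ℝ) ^ 3) := by
        rw [Finset.sum_const, Nat.card_Icc, Nat.add_sub_cancel, nsmul_eq_mul,
          ← ENNReal.ofReal_natCast, ← ENNReal.ofReal_mul (Nat.cast_nonneg n)]
        congr 1
        field_simp

end Concentration

/-! ### Almost sure structure of HOO histories -/

section Regular

variable {X : Type*} [MeasurableSpace X] {n : ℕ}

/-- Properties that the history of a HOO strategy has almost surely. -/
structure IsRegular (P : TreeOfCoverings X) (H : History X n) : Prop where
  isValid : ∀ t, (H t).1.IsValid
  depth_le : ∀ t, (H t).1.1 ≤ n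
  injective : Function.Injective fun t => (H t).1
  isDescendant_root : ∀ t, IsDescendant root (H t).1
  ancestor : ∀ t v, IsDescendant v (H t).1 → v = root ∨ ∃ s, (H s).1 = v
  mem_region : ∀ t, (H t).2.1 ∈ P.region (H t).1

theorem measurableSet_isRegular (P : TreeOfCoverings X) :
    MeasurableSet {H : History X n | IsRegular P H} := by
  -- The region varies with the played node and is known to be measurable only at valid nodes, so
  -- the condition on the arm is cut along the countably many values of the node.
  have heq : {H : History X n | IsRegular P H}
      = {H | (∀ t, (H t).1.IsValid) ∧ (∀ t, (H t).1.1 ≤ n) ∧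
          (Function.Injective fun t => (H t).1) ∧ (∀ t, IsDescendant root (H t).1) ∧
          ∀ t v, IsDescendant v (H t).1 → v = root ∨ ∃ s, (H s).1 = v}
        ∩ {H | ∀ t, ∃ v : Node, v.IsValid ∧ (H t).1 = v ∧ (H t).2.1 ∈ P.region v} := by
    ext H
    constructor
    · rintro ⟨h1, h2, h3, h4, h5, h6⟩
      exact ⟨⟨h1, h2, h3, h4, h5⟩, fun t => ⟨_, h1 t, rfl, h6 t⟩⟩
    · rintro ⟨⟨h1, h2, h3, h4, h5⟩, h6⟩
      refine ⟨h1, h2, h3, h4, h5, fun t => ?_⟩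
      obtain ⟨v, -, rfl, h⟩ := h6 t
      exact h
  rw [heq]
  refine (measurableSet_nodes fun N : Fin n → Node => (∀ t, (N t).IsValid) ∧ (∀ t, (N t).1 ≤ n) ∧
    Function.Injective N ∧ (∀ t, IsDescendant root (N t)) ∧
    ∀ t v, IsDescendant v (N t) → v = root ∨ ∃ s, N s = v).inter ?_
  rw [Set.ofPred_forall]
  refine MeasurableSet.iInter fun t => ?_
  rw [Set.ofPred_exists]
  refine MeasurableSet.iUnion fun v => ?_
  by_cases hv : v.IsValid
  · simp only [hv, true_and]
    refine (measurableSet_nodes fun N : Fin n → Node => N t = v).inter ?_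
    exact (show Measurable fun H : History X n => (H t).2.1 by fun_prop)
      (P.measurableSet_region v hv)
  · simp [hv]

omit [MeasurableSpace X] in
theorem extend_castSucc (H : History X n) (a : Node × X) (y : ℝ) (t : Fin n) :
    extend (H, a, y) t.castSucc = H t := by
  simp [extend]

omit [MeasurableSpace X] in
theorem extend_last (H : History X n) (a : Node × X) (y : ℝ) :
    extend (H, a, y) (Fin.last n) = (a.1, a.2, y) := by
  simp [extend]

omit [MeasurableSpace X] in
theorem mem_tree {H : History X n} {v : Node} : v ∈ tree H ↔ v = root ∨ ∃ s, (H s).1 = v := by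
  simp [tree]

/-- The selected node is outside the tree, hence new, while its proper ancestors were crossed, hence
are in the tree. The root is in the tree from the start without being played, which explains its
special role in `ancestor`. -/
theorem IsRegular.extend {P : TreeOfCoverings X} {ν₁ ρ : ℝ} {H : History X n}
    (hH : IsRegular P H) {a : Node × X} (ha : IsSelected ν₁ ρ H a.1)
    (ha' : a.2 ∈ P.region a.1) (y : ℝ) : IsRegular P (XArmedBandit.extend (H, a, y)) := by
  obtain ⟨hreach, hnot⟩ := ha
  have hlift : ∀ v, v ∈ tree H →
      v = root ∨ ∃ s, (XArmedBandit.extend (H, a, y) s).1 = v := by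
    intro v hv
    refine (mem_tree.mp hv).imp id ?_
    rintro ⟨s, hs⟩
    exact ⟨s.castSucc, by rw [extend_castSucc, hs]⟩
  have hne : ∀ t, (H t).1 ≠ a.1 := fun t ht => hnot (mem_tree.mpr (Or.inr ⟨t, ht⟩))
  refine ⟨?_, ?_, ?_, ?_, ?_, ?_⟩
  · rw [Fin.forall_fin_succ']
    simp only [extend_castSucc, extend_last]
    exact ⟨hH.isValid, hreach.isValid⟩
  · rw [Fin.forall_fin_succ']
    simp only [extend_castSucc, extend_last]
    refine ⟨fun t => (hH.depth_le t).trans (Nat.le_succ n), hreach.depth_le fun w hw => ?_⟩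
    rcases mem_tree.mp hw with rfl | ⟨s, rfl⟩
    · exact Nat.zero_le _
    · exact hH.depth_le s
  · intro s t hst
    induction s using Fin.lastCases with
    | last =>
      induction t using Fin.lastCases with
      | last => rfl
      | cast t =>
        simp only [extend_castSucc, extend_last] at hst
        exact absurd hst.symm (hne t)
    | cast s =>
      induction t using Fin.lastCases with
      | last =>
        simp only [extend_castSucc, extend_last] at hst
        exact absurd hst (hne s)
      | cast t =>
        simp only [extend_castSucc] at hst
        rw [hH.injective hst]
  · rw [Fin.forall_fin_succ']
    simp only [extend_castSucc, extend_last]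
    exact ⟨hH.isDescendant_root, hreach.isDescendant_root⟩
  · rw [Fin.forall_fin_succ']
    simp only [extend_castSucc, extend_last]
    refine ⟨fun t v hv => hlift v (mem_tree.mpr (hH.ancestor t v hv)), fun v hv => ?_⟩
    rcases (hreach.of_isDescendant hv).2 with rfl | h
    · exact Or.inr ⟨Fin.last n, by rw [extend_last]⟩
    · exact hlift v h
  · rw [Fin.forall_fin_succ']
    simp only [extend_castSucc, extend_last]
    exact ⟨hH.mem_region, ha'⟩

theorem Strategy.IsHOO.ae_isRegular {φ : Strategy X} {ν₁ ρ : ℝ} {P : TreeOfCoverings X}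
    (hφ : φ.IsHOO ν₁ ρ P) (M : Environment X) (n : ℕ) : ∀ᵐ H ∂(law φ M n), IsRegular P H := by
  induction n with
  | zero =>
    refine Eventually.of_forall fun H => ⟨fun t => t.elim0, fun t => t.elim0, fun t => t.elim0,
      fun t => t.elim0, fun t => t.elim0, fun t => t.elim0⟩
  | succ n ih =>
    refine ae_law_succ (measurableSet_isRegular P) ?_
    filter_upwards [ih] with H hH
    filter_upwards [hφ n H] with a ha y
    exact hH.extend ha.1 ha.2 y

theorem IsRegular.mem_tree {P : TreeOfCoverings X} {H : History X n} (hH : IsRegular P H)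
    {v : Node} (hv : 1 ≤ visitCount H v) : v ∈ tree H := by
  classical
  obtain ⟨t, ht⟩ := Finset.card_pos.mp hv
  simp only [visits, Finset.mem_filter] at ht
  exact XArmedBandit.mem_tree.mpr (hH.ancestor t v ht.2)

theorem IsRegular.visitCount_eq_zero {P : TreeOfCoverings X} {H : History X n}
    (hH : IsRegular P H) {v : Node} (hv : n < v.1) : visitCount H v = 0 := by
  classical
  refine Finset.card_eq_zero.mpr (Finset.filter_eq_empty_iff.mpr fun t _ ht => ?_)
  have := ht.depth_le
  have := hH.depth_le t
  omega

theorem TreeOfCoverings.region_subset_aux (P : TreeOfCoverings X) {v w : Node} (hv : v.IsValid)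
    (h : IsDescendant v w) : w.IsValid ∧ P.region w ⊆ P.region v := by
  induction h with
  | refl => exact ⟨hv, subset_rfl⟩
  | left w _ ih =>
    refine ⟨ih.1.leftChild, Set.Subset.trans ?_ ih.2⟩
    rw [P.region_eq_union w ih.1]
    exact Set.subset_union_left
  | right w _ ih =>
    refine ⟨ih.1.rightChild, Set.Subset.trans ?_ ih.2⟩
    rw [P.region_eq_union w ih.1]
    exact Set.subset_union_right

theorem TreeOfCoverings.region_subset (P : TreeOfCoverings X) {v w : Node} (hv : v.IsValid)
    (h : IsDescendant v w) : P.region w ⊆ P.region v :=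
  (P.region_subset_aux hv h).2

theorem IsRegular.arm_mem_region {P : TreeOfCoverings X} {H : History X n} (hH : IsRegular P H)
    {v : Node} (hv : v.IsValid) {t : Fin n} (ht : t ∈ visits H v) :
    (H t).2.1 ∈ P.region v := by
  classical
  simp only [visits, Finset.mem_filter] at ht
  exact P.region_subset hv ht.2 (hH.mem_region t)

end Regular

/-! ### Confidence bounds and excess visits -/

section VisitBound

variable {X : Type*} [MeasurableSpace X] {n : ℕ}

theorem sqrt_two_log_div {T L : ℝ} (hT : 0 < T) : √(2 * L / T) = √(2 * T * L) / T := by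
  rw [← Real.sqrt_sq hT.le, ← Real.sqrt_div' _ (by positivity), Real.sqrt_sq hT.le]
  congr 1
  field_simp

/-- The term `ν₁ρ^h` pays for the gaps in the region, the square root for the noise. -/
theorem IsRegular.best_le_Uvalue {P : TreeOfCoverings X} {H : History X n} (hH : IsRegular P H)
    {M : Environment X} {ν₁ ρ : ℝ} {v : Node} (hv : v.IsValid)
    (hopt : ∀ x ∈ P.region v, M.best - M.mean x ≤ ν₁ * ρ ^ v.1)
    (hdev : H ∉ deviationEvent M n (-1) v) : (M.best : EReal) ≤ Uvalue ν₁ ρ H v := by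
  rw [Uvalue]
  split_ifs with h0
  · rw [EReal.coe_le_coe_iff]
    have hT : (0 : ℝ) < visitCount H v := by exact_mod_cast h0
    have hS : -noise M H v < √(2 * visitCount H v * Real.log n) := by
      by_contra! h
      exact hdev ⟨h0, by linarith⟩
    have hsum : (visitCount H v : ℝ) * (M.best - ν₁ * ρ ^ v.1)
        ≤ ∑ t ∈ visits H v, M.mean (H t).2.1 := by
      rw [visitCount, ← nsmul_eq_mul]
      refine Finset.card_nsmul_le_sum _ _ _ fun t ht => ?_
      have := hopt _ (hH.arm_mem_region hv ht)
      linarith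
    have hmean := visitCount_mul_empMean M (H := H) (v := v)
    rw [sqrt_two_log_div hT]
    refine le_of_mul_le_mul_left ?_ hT
    have : (visitCount H v : ℝ) * (√(2 * visitCount H v * Real.log n) / visitCount H v)
      = √(2 * visitCount H v * Real.log n) := by field_simp
    nlinarith
  · exact le_top

/-- The empirical mean is below `f* - 2ν₁ρ^h` plus one confidence width, and `U` adds `ν₁ρ^h` and a
second width. The visit threshold makes two widths at most `ν₁ρ^h`. -/
theorem IsRegular.Uvalue_lt_best {P : TreeOfCoverings X} {H : History X n} (hH : IsRegular P H)
    {M : Environment X} {ν₁ ρ : ℝ} {v : Node} (hv : v.IsValid) (hb : 0 ≤ ν₁ * ρ ^ v.1)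
    (hsub : ∀ x ∈ P.region v, 2 * (ν₁ * ρ ^ v.1) ≤ M.best - M.mean x)
    (h0 : 1 ≤ visitCount H v)
    (hT : 8 * Real.log n ≤ visitCount H v * (ν₁ * ρ ^ v.1) ^ 2)
    (hdev : H ∉ deviationEvent M n 1 v) : Uvalue ν₁ ρ H v < (M.best : EReal) := by
  rw [Uvalue, if_pos (Nat.lt_of_succ_le h0), EReal.coe_lt_coe_iff]
  have hT0 : (0 : ℝ) < visitCount H v := by exact_mod_cast h0
  have hS : noise M H v < √(2 * visitCount H v * Real.log n) := by
    by_contra! h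
    exact hdev ⟨h0, by linarith⟩
  have hsum : ∑ t ∈ visits H v, M.mean (H t).2.1
      ≤ (visitCount H v : ℝ) * (M.best - 2 * (ν₁ * ρ ^ v.1)) := by
    rw [visitCount, ← nsmul_eq_mul]
    refine Finset.sum_le_card_nsmul _ _ _ fun t ht => ?_
    have := hsub _ (hH.arm_mem_region hv ht)
    linarith
  have hmean := visitCount_mul_empMean M (H := H) (v := v)
  have hsqrt : 2 * √(2 * visitCount H v * Real.log n) ≤ visitCount H v * (ν₁ * ρ ^ v.1) := by
    have : √(2 * visitCount H v * Real.log n) ≤ visitCount H v * (ν₁ * ρ ^ v.1) / 2 := by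
      refine Real.sqrt_le_iff.mpr ⟨by positivity, ?_⟩
      nlinarith
    linarith
  rw [sqrt_two_log_div hT0]
  refine lt_of_mul_lt_mul_left ?_ hT0.le
  have : (visitCount H v : ℝ) * (√(2 * visitCount H v * Real.log n) / visitCount H v)
    = √(2 * visitCount H v * Real.log n) := by field_simp
  nlinarith

/-- The expected number of visits beyond the first `u` ones is controlled by the probabilities of
events outside of which a node that was visited `u` times is not reached. -/
theorem Strategy.IsHOO.lintegral_visitCount_sub_le {φ : Strategy X} {ν₁ ρ : ℝ}
    {P : TreeOfCoverings X} (hφ : φ.IsHOO ν₁ ρ P) (M : Environment X) (v : Node) (u : ℕ)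
    {E : ∀ t, Set (History X t)} (hE : ∀ t, MeasurableSet (E t))
    (hreach : ∀ t < n, ∀ᵐ H ∂(law φ M t), IsReached ν₁ ρ H v → u ≤ visitCount H v → H ∈ E t) :
    ∫⁻ H, ((visitCount H v - u : ℕ) : ℝ≥0∞) ∂(law φ M n)
      ≤ ∑ t ∈ Finset.range n, law φ M t (E t) := by
  classical
  induction n with
  | zero => simp [visitCount_eq_sum]
  | succ n ih =>
    have hmeas : ∀ m, Measurable fun H : History X m => ((visitCount H v - u : ℕ) : ℝ≥0∞) :=
      fun m => (measurable_from_top (f := fun k : ℕ => ((k - u : ℕ) : ℝ≥0∞))).comp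
        (measurable_visitCount v)
    rw [Finset.sum_range_succ, lintegral_law_succ φ M (hmeas _)]
    refine le_trans ?_ (add_le_add_left (ih fun t ht => hreach t (by omega)) _)
    rw [← lintegral_indicator_one (hE n), ← lintegral_add_left (hmeas n)]
    refine lintegral_mono_ae ?_
    filter_upwards [hreach n (Nat.lt_succ_self n)] with H hH
    refine (lintegral_mono_ae (g := fun _ => ((visitCount H v - u : ℕ) : ℝ≥0∞)
      + (E n).indicator 1 H) ?_).trans (by simp)
    filter_upwards [hφ n H] with a ha
    simp only [visitCount_extend, lintegral_const, measure_univ, mul_one]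
    -- The truncated difference grows only if a descendant of `v` is played after at least `u`
    -- visits; then `v` was reached and the history lies in `E n`.
    by_cases hd : IsDescendant v a.1
    · by_cases hu : u ≤ visitCount H v
      · have hmem := hH (ha.1.1.of_isDescendant hd).1 hu
        rw [if_pos hd, Set.indicator_of_mem hmem, Nat.sub_add_comm hu]
        simp
      · have : visitCount H v + 1 - u = 0 := by omega
        simp [hd, this]
    · simp [hd]

end VisitBound

/-! ### Packing dimension against the branching of the tree -/

section Dimension

variable {X : Type*} [MeasurableSpace X] {l : Dissimilarity X} {ν₁ ρ ν₂ : ℝ}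
  {P : TreeOfCoverings X}

theorem ShrinkingRegions.two_pow_le_packingNumber (hA : ShrinkingRegions l ν₁ ρ ν₂ P)
    (hρ₀ : 0 < ρ) (hν₂ : 0 < ν₂) (h : ℕ) :
    ((2 ^ h : ℕ) : ℕ∞) ≤ packingNumber l Set.univ (ν₂ * ρ ^ h) := by
  classical
  obtain ⟨-, c, -, hdisj⟩ := hA
  have hr : 0 < ν₂ * ρ ^ h := by positivity
  have hmem : ∀ x, x ∈ ball l x (ν₂ * ρ ^ h) := fun x => by
    simpa only [ball, Set.mem_ofPred_eq, l.self] using hr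
  have hne : ∀ i ∈ Finset.Icc 1 (2 ^ h), ∀ j ∈ Finset.Icc 1 (2 ^ h), i ≠ j →
      Disjoint (ball l (c (h, i)) (ν₂ * ρ ^ h)) (ball l (c (h, j)) (ν₂ * ρ ^ h)) := by
    intro i hi j hj hij
    rw [Finset.mem_Icc] at hi hj
    rcases lt_or_gt_of_ne hij with hlt | hlt
    · exact hdisj h i j hi.1 hlt hj.2
    · exact (hdisj h j i hj.1 hlt hi.2).symm
  have hinj : Set.InjOn (fun i => c (h, i)) (Finset.Icc 1 (2 ^ h) : Finset ℕ) := by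
    intro i hi j hj hij
    by_contra hij'
    have := hne i hi j hj hij'
    simp only at hij
    rw [hij] at this
    exact Set.disjoint_left.mp this (hmem _) (hmem _)
  have hcard : ((Finset.Icc 1 (2 ^ h)).image fun i => c (h, i)).card = 2 ^ h := by
    rw [Finset.card_image_of_injOn hinj, Nat.card_Icc, Nat.add_sub_cancel]
  rw [← hcard, packingNumber]
  refine le_iSup₂_of_le _ ⟨fun _ _ => Set.subset_univ _, ?_⟩ le_rfl
  intro x hx y hy hxy
  simp only [Finset.coe_image, Set.mem_image] at hx hy
  obtain ⟨i, hi, rfl⟩ := hx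
  obtain ⟨j, hj, rfl⟩ := hy
  exact hne i hi j hj fun hij => hxy (hij ▸ rfl)

/-- A binary tree of disjoint balls of geometrically decreasing radii forces the packing dimension
to be at least `log 2 / log ρ⁻¹`. -/
theorem ShrinkingRegions.log_two_le (hA : ShrinkingRegions l ν₁ ρ ν₂ P) (hρ₀ : 0 < ρ)
    (hρ₁ : ρ < 1) (hν₂ : 0 < ν₂) {D' : ℝ} (hD' : packingDimension l Set.univ < (D' : EReal)) :
    Real.log 2 ≤ D' * Real.log ρ⁻¹ := by
  have hev := eventually_lt_of_limsup_lt hD'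
  have htend0 : Tendsto (fun h : ℕ => ν₂ * ρ ^ h) atTop (𝓝 0) := by
    simpa using (tendsto_pow_atTop_nhds_zero_of_lt_one hρ₀.le hρ₁).const_mul ν₂
  have htend : Tendsto (fun h : ℕ => ν₂ * ρ ^ h) atTop (𝓝[>] 0) :=
    tendsto_nhdsWithin_iff.mpr ⟨htend0, Eventually.of_forall fun h => by
      simp only [Set.mem_Ioi]; positivity⟩
  -- The dimension bound at the radii `ν₂ρ^h`, once they are below `1` and the logarithm in the
  -- denominator is positive. Only the terms linear in `h` matter in the limit, so `ν₂` disappears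
  -- from the conclusion.
  have hmain : ∀ᶠ h : ℕ in atTop,
      h * Real.log 2 < D' * (Real.log ν₂⁻¹ + h * Real.log ρ⁻¹) := by
    filter_upwards [htend.eventually hev, htend0.eventually (gt_mem_nhds one_pos)] with h h1 h2
    have hr : 0 < ν₂ * ρ ^ h := by positivity
    have hlog : 0 < Real.log (ν₂ * ρ ^ h)⁻¹ := Real.log_pos ((one_lt_inv₀ hr).mpr h2)
    rw [EReal.div_lt_iff (by exact_mod_cast hlog) (EReal.coe_ne_top _)] at h1
    have h3 : ENNReal.log (((2 ^ h : ℕ) : ℕ∞) : ℝ≥0∞)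
        ≤ ENNReal.log ((packingNumber l Set.univ (ν₂ * ρ ^ h) : ℕ∞) : ℝ≥0∞) :=
      ENNReal.log_monotone
        (ENat.toENNReal_le.mpr (hA.two_pow_le_packingNumber hρ₀ hν₂ h))
    have h4 : (((2 ^ h : ℕ) : ℕ∞) : ℝ≥0∞) = ENNReal.ofReal (2 ^ h) := by
      rw [ENat.toENNReal_coe, ← ENNReal.ofReal_natCast]
      push_cast
      rfl
    rw [h4, ENNReal.log_ofReal_of_pos (by positivity)] at h3
    have h5 := h3.trans_lt h1
    rw [← EReal.coe_mul, EReal.coe_lt_coe_iff, Real.log_pow, mul_inv,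
      Real.log_mul (by positivity) (by positivity), ← inv_pow, Real.log_pow] at h5
    exact h5
  by_contra! hlt
  have hδ : 0 < Real.log 2 - D' * Real.log ρ⁻¹ := by linarith
  obtain ⟨h, h1, h2⟩ := (hmain.and (eventually_ge_atTop
    ⌈D' * Real.log ν₂⁻¹ / (Real.log 2 - D' * Real.log ρ⁻¹)⌉₊)).exists
  have h3 := (Nat.le_ceil _).trans (Nat.cast_le (α := ℝ).mpr h2)
  rw [div_le_iff₀ hδ] at h3
  nlinarith

end Dimension

/-! ### A path of optimal nodes -/

section OptimalPath

variable {X : Type*} [MeasurableSpace X] {l : Dissimilarity X} {ν₁ ρ ν₂ : ℝ}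
  {P : TreeOfCoverings X} {M : Environment X}

theorem ShrinkingRegions.dissimilarity_le (hA : ShrinkingRegions l ν₁ ρ ν₂ P) (hν₁ : 0 < ν₁)
    (hρ₀ : 0 < ρ) {v : Node} (hv : v.IsValid) {x y : X} (hx : x ∈ P.region v)
    (hy : y ∈ P.region v) : l x y ≤ ν₁ * ρ ^ v.1 := by
  have h1 : ENNReal.ofReal (l x y) ≤ diam l (P.region v) :=
    (le_iSup₂ (f := fun y (_ : y ∈ P.region v) => ENNReal.ofReal (l x y)) y hy).trans
      (le_iSup₂ (f := fun x (_ : x ∈ P.region v) =>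
        ⨆ y ∈ P.region v, ENNReal.ofReal (l x y)) x hx)
  exact (ENNReal.ofReal_le_ofReal_iff (by positivity)).mp (h1.trans (hA.1 v hv))

theorem ShrinkingRegions.gap_le (hA : ShrinkingRegions l ν₁ ρ ν₂ P) (hν₁ : 0 < ν₁)
    (hρ₀ : 0 < ρ) (hM : M.IsWeaklyLipschitz l) {v : Node} (hv : v.IsValid) {x y : X}
    (hx : x ∈ P.region v) (hy : y ∈ P.region v) :
    M.best - M.mean y
      ≤ M.best - M.mean x + max (M.best - M.mean x) (ν₁ * ρ ^ v.1) :=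
  (hM x y).trans (add_le_add_right (max_le_max le_rfl (hA.dissimilarity_le hν₁ hρ₀ hv hx hy)) _)

/-- The supremum of the mean-payoff function is approached within the region of `v`. -/
def IsOptimal (P : TreeOfCoverings X) (M : Environment X) (v : Node) : Prop :=
  v.IsValid ∧ ∀ ε > 0, ∃ x ∈ P.region v, M.best - M.mean x < ε

theorem isOptimal_root [Nonempty X] (P : TreeOfCoverings X) (M : Environment X) :
    IsOptimal P M root := by
  refine ⟨root_isValid, fun ε hε => ?_⟩
  obtain ⟨x, hx⟩ := exists_lt_of_lt_ciSup (f := M.mean) (sub_lt_self M.best hε)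
  exact ⟨x, P.region_root ▸ Set.mem_univ x, by linarith⟩

theorem IsOptimal.child {v : Node} (hv : IsOptimal P M v) :
    IsOptimal P M (leftChild v) ∨ IsOptimal P M (rightChild v) := by
  by_contra! h
  obtain ⟨h1, h2⟩ := h
  simp only [IsOptimal, hv.1.leftChild, hv.1.rightChild, true_and, not_forall, not_exists,
    not_and, not_lt, exists_prop] at h1 h2
  obtain ⟨ε₁, hε₁, h1⟩ := h1
  obtain ⟨ε₂, hε₂, h2⟩ := h2
  obtain ⟨x, hx, hlt⟩ := hv.2 (min ε₁ ε₂) (lt_min hε₁ hε₂)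
  rw [P.region_eq_union v hv.1] at hx
  rcases hx with hx | hx
  · exact absurd (hlt.trans_le (min_le_left _ _)) (not_lt.mpr (h1 x hx))
  · exact absurd (hlt.trans_le (min_le_right _ _)) (not_lt.mpr (h2 x hx))

/-- Comparing with a point whose gap is below both `ε` and `ν₁ρ^h` turns the maximum in the weak
Lipschitz condition into `ν₁ρ^h`. The supremum need not be attained, hence the `ε`. -/
theorem IsOptimal.gap_le (hA : ShrinkingRegions l ν₁ ρ ν₂ P) (hν₁ : 0 < ν₁)
    (hρ₀ : 0 < ρ) (hM : M.IsWeaklyLipschitz l) {v : Node} (hv : IsOptimal P M v) {y : X}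
    (hy : y ∈ P.region v) : M.best - M.mean y ≤ ν₁ * ρ ^ v.1 := by
  refine le_of_forall_pos_le_add fun ε hε => ?_
  have hb : 0 < ν₁ * ρ ^ v.1 := by positivity
  obtain ⟨x, hx, hlt⟩ := hv.2 (min ε (ν₁ * ρ ^ v.1)) (lt_min hε hb)
  have h1 := hA.gap_le hν₁ hρ₀ hM hv.1 hx hy
  rw [max_eq_right (hlt.le.trans (min_le_right _ _))] at h1
  linarith [hlt.trans_le (min_le_left ε (ν₁ * ρ ^ v.1))]

theorem exists_optimal_path [Nonempty X] (P : TreeOfCoverings X) (M : Environment X) :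
    ∃ w : ℕ → Node, w 0 = root ∧
      (∀ j, w (j + 1) = leftChild (w j) ∨ w (j + 1) = rightChild (w j)) ∧
      ∀ j, (w j).1 = j ∧ IsOptimal P M (w j) := by
  have hstep : ∀ v : {v // IsOptimal P M v}, ∃ v' : {v // IsOptimal P M v},
      v'.1 = leftChild v.1 ∨ v'.1 = rightChild v.1 := by
    rintro ⟨v, hv⟩
    rcases hv.child with h | h
    · exact ⟨⟨_, h⟩, Or.inl rfl⟩
    · exact ⟨⟨_, h⟩, Or.inr rfl⟩
  choose g hg using hstep
  have hsucc : ∀ j, (g^[j + 1] ⟨root, isOptimal_root P M⟩).1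
      = leftChild (g^[j] ⟨root, isOptimal_root P M⟩).1 ∨
      (g^[j + 1] ⟨root, isOptimal_root P M⟩).1
      = rightChild (g^[j] ⟨root, isOptimal_root P M⟩).1 := by
    intro j
    rw [Function.iterate_succ_apply']
    exact hg _
  refine ⟨fun j => (g^[j] ⟨root, isOptimal_root P M⟩).1, rfl, hsucc, fun j => ⟨?_, Subtype.prop _⟩⟩
  induction j with
  | zero => rfl
  | succ j ih =>
    rcases hsucc j with h | h <;>
      exact (congrArg Prod.fst h).trans (congrArg (fun d => d + 1) ih)

end OptimalPath

/-! ### Expected visits to suboptimal nodes -/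

section ExpectedVisits

variable {X : Type*} [MeasurableSpace X] {l : Dissimilarity X} {ν₁ ρ ν₂ : ℝ}
  {P : TreeOfCoverings X} {M : Environment X} {φ : Strategy X}

theorem sum_range_le_seven {c : ℕ → ℝ≥0∞} (h0 : c 0 ≤ 1)
    (hc : ∀ t, 1 ≤ t → c t ≤ ENNReal.ofReal (3 / (t : ℝ) ^ 2)) (n : ℕ) :
    ∑ t ∈ Finset.range n, c t ≤ ENNReal.ofReal 7 := by
  -- Telescoping majorant: its increment `6 / ((m + 1) * (m + 2))` is at least `3 / (m + 1) ^ 2`.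
  have key : ∀ m : ℕ, ∑ t ∈ Finset.range (m + 1), c t
      ≤ ENNReal.ofReal (7 - 6 / ((m : ℝ) + 1)) := by
    intro m
    induction m with
    | zero => norm_num; exact h0
    | succ m ih =>
      rw [Finset.sum_range_succ]
      have hm : (0 : ℝ) ≤ m := Nat.cast_nonneg m
      have h1 : 6 / ((m : ℝ) + 1) ≤ 6 := div_le_self (by norm_num) (by linarith)
      refine (add_le_add ih (hc (m + 1) (by omega))).trans ?_
      rw [← ENNReal.ofReal_add (by linarith) (by positivity)]
      refine ENNReal.ofReal_le_ofReal ?_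
      push_cast
      have h2 : 7 - 6 / ((m : ℝ) + 1 + 1) - (7 - 6 / ((m : ℝ) + 1) + 3 / ((m : ℝ) + 1) ^ 2)
          = 3 * m / (((m : ℝ) + 1) ^ 2 * (m + 2)) := by
        field_simp
        ring
      have h3 : 0 ≤ 3 * m / (((m : ℝ) + 1) ^ 2 * (m + 2)) := by positivity
      linarith
  cases n with
  | zero => simp
  | succ m =>
    refine (key m).trans (ENNReal.ofReal_le_ofReal ?_)
    have : 0 ≤ 6 / ((m : ℝ) + 1) := by positivity
    linarith

/-- A node the region of which is far from optimal is played rarely. -/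
theorem Strategy.IsHOO.integral_visitCount_le [Nonempty X] (hφ : φ.IsHOO ν₁ ρ P)
    (hA : ShrinkingRegions l ν₁ ρ ν₂ P) (hν₁ : 0 < ν₁) (hρ₀ : 0 < ρ)
    (hM : M.IsWeaklyLipschitz l) {v : Node} (hv : v.IsValid)
    (hsub : ∀ x ∈ P.region v, 2 * (ν₁ * ρ ^ v.1) ≤ M.best - M.mean x) {n : ℕ} (hn : 1 ≤ n) :
    ∫ H, (visitCount H v : ℝ) ∂(law φ M n)
      ≤ 8 * Real.log n / (ν₁ * ρ ^ v.1) ^ 2 + 9 := by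
  have hb : 0 < ν₁ * ρ ^ v.1 := by positivity
  have hlogn : 0 ≤ Real.log n := Real.log_nonneg (by exact_mod_cast hn)
  obtain ⟨w, hw₀, hw, hopt⟩ := exists_optimal_path P M
  -- The added `1` makes sure that a node visited `u` times has a nonzero count.
  set u := ⌈8 * Real.log n / (ν₁ * ρ ^ v.1) ^ 2⌉₊ + 1 with hu
  -- At most `t + 2 ≤ 3 * t` deviations of probability `t⁻³`: path nodes too low, or `v` too high.
  -- Depths up to `t` suffice, since deeper nodes are unvisited and have `U = ⊤`.
  let E : ∀ t, Set (History X t) := fun t =>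
    (⋃ j ∈ Finset.range (t + 1), deviationEvent M t (-1) (w j)) ∪ deviationEvent M t 1 v
  have hE : ∀ t, MeasurableSet (E t) := fun t =>
    (Finset.measurableSet_biUnion _ fun j _ => measurableSet_deviationEvent M t (-1) (w j)).union
      (measurableSet_deviationEvent M t 1 v)
  have hprob : ∀ t, 1 ≤ t → law φ M t (E t) ≤ ENNReal.ofReal (3 / (t : ℝ) ^ 2) := by
    intro t ht
    have ht1 : (1 : ℝ) ≤ t := by exact_mod_cast ht
    calc law φ M t (E t)
        ≤ ∑ j ∈ Finset.range (t + 1), ENNReal.ofReal (1 / (t : ℝ) ^ 3)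
          + ENNReal.ofReal (1 / (t : ℝ) ^ 3) :=
          (measure_union_le _ _).trans (add_le_add ((measure_biUnion_finset_le _ _).trans
            (Finset.sum_le_sum fun j _ => law_deviationEvent_le φ M ht (by norm_num) (w j)))
            (law_deviationEvent_le φ M ht (by norm_num) v))
      _ = ENNReal.ofReal (((t + 1 : ℕ) : ℝ) * (1 / (t : ℝ) ^ 3) + 1 / (t : ℝ) ^ 3) := by
          rw [Finset.sum_const, Finset.card_range, nsmul_eq_mul, ← ENNReal.ofReal_natCast,
            ← ENNReal.ofReal_mul (Nat.cast_nonneg _), ← ENNReal.ofReal_add (by positivity)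
            (by positivity)]
      _ ≤ ENNReal.ofReal (3 / (t : ℝ) ^ 2) := by
          refine ENNReal.ofReal_le_ofReal ?_
          have h1 : 3 / (t : ℝ) ^ 2 = 3 * t * (1 / (t : ℝ) ^ 3) := by field_simp
          rw [h1]
          push_cast
          have h2 : 0 < 1 / (t : ℝ) ^ 3 := by positivity
          nlinarith
  have hreach : ∀ t < n, ∀ᵐ H ∂(law φ M t), IsReached ν₁ ρ H v → u ≤ visitCount H v → H ∈ E t := by
    intro t ht
    filter_upwards [hφ.ae_isRegular M t] with H hH hR huv
    by_contra hHE
    simp only [E, Set.mem_union, Set.mem_iUnion, not_or, not_exists] at hHE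
    have h1 : 1 ≤ visitCount H v := by omega
    have ht0 : (0 : ℝ) < t := by
      have := visitCount_le H v
      exact_mod_cast (by omega : 0 < t)
    have hup : ∀ j, (M.best : EReal) ≤ Uvalue ν₁ ρ H (w j) := by
      intro j
      by_cases hj : j ≤ t
      · exact hH.best_le_Uvalue (hopt j).2.1
          (fun x hx => IsOptimal.gap_le hA hν₁ hρ₀ hM (hopt j).2 hx)
          (hHE.1 j (Finset.mem_range.mpr (by omega)))
      · rw [Uvalue, if_neg]
        · exact le_top
        · rw [hH.visitCount_eq_zero (by rw [(hopt j).1]; omega)]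
          exact lt_irrefl 0
    refine absurd (hR.le_Uvalue (hH.mem_tree h1) hw₀ hw hup)
      (not_le.mpr (hH.Uvalue_lt_best hv hb.le hsub h1 ?_ hHE.2))
    have h2 : Real.log t ≤ Real.log n :=
      Real.log_le_log ht0 (by exact_mod_cast ht.le)
    have h3 : 8 * Real.log n / (ν₁ * ρ ^ v.1) ^ 2 ≤ visitCount H v :=
      (Nat.le_ceil _).trans (by exact_mod_cast (by omega :
        ⌈8 * Real.log n / (ν₁ * ρ ^ v.1) ^ 2⌉₊ ≤ visitCount H v))
    rw [div_le_iff₀ (by positivity)] at h3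
    linarith
  have hlint := (hφ.lintegral_visitCount_sub_le M v u hE hreach).trans
    (sum_range_le_seven prob_le_one hprob n)
  have hmeasT : Measurable fun H : History X n => (visitCount H v : ℝ) :=
    measurable_from_top.comp (measurable_visitCount v)
  rw [integral_eq_lintegral_of_nonneg_ae (Eventually.of_forall fun H => Nat.cast_nonneg _)
    hmeasT.aestronglyMeasurable]
  refine ENNReal.toReal_le_of_le_ofReal (by positivity) ?_
  calc ∫⁻ H, ENNReal.ofReal (visitCount H v : ℝ) ∂(law φ M n)
      ≤ ∫⁻ H, ((u : ℝ≥0∞) + ((visitCount H v - u : ℕ) : ℝ≥0∞)) ∂(law φ M n) := by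
        refine lintegral_mono fun H => ?_
        rw [ENNReal.ofReal_natCast]
        rw [← Nat.cast_add]
        exact Nat.cast_le.mpr (by omega)
    _ ≤ ENNReal.ofReal u + ENNReal.ofReal 7 := by
        rw [lintegral_add_left measurable_const, lintegral_const, measure_univ, mul_one,
          ENNReal.ofReal_natCast]
        gcongr
    -- The `9` collects `1` from rounding up, `1` from the definition of `u` and `7` from the
    -- deviations.
    _ ≤ ENNReal.ofReal (8 * Real.log n / (ν₁ * ρ ^ v.1) ^ 2 + 9) := by
        rw [← ENNReal.ofReal_add (by positivity) (by norm_num)]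
        refine ENNReal.ofReal_le_ofReal ?_
        have := Nat.ceil_lt_add_one
          (show 0 ≤ 8 * Real.log n / (ν₁ * ρ ^ v.1) ^ 2 by positivity)
        rw [hu]
        push_cast
        linarith

end ExpectedVisits

/-! ### Decomposition of the regret -/

section RegretBound

variable {X : Type*} [MeasurableSpace X] {l : Dissimilarity X} {ν₁ ρ ν₂ : ℝ}
  {P : TreeOfCoverings X} {M : Environment X} {φ : Strategy X}

/-- The region of `v` contains a point that is optimal up to twice the scale of `v`. -/
def IsNearOptimal (ν₁ ρ : ℝ) (P : TreeOfCoverings X) (M : Environment X) (v : Node) : Prop :=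
  ∃ x ∈ P.region v, M.best - M.mean x ≤ 2 * (ν₁ * ρ ^ v.1)

theorem IsNearOptimal.gap_le (hA : ShrinkingRegions l ν₁ ρ ν₂ P) (hν₁ : 0 < ν₁)
    (hρ₀ : 0 < ρ) (hM : M.IsWeaklyLipschitz l) {v : Node} (hv : v.IsValid)
    (h : IsNearOptimal ν₁ ρ P M v) {y : X} (hy : y ∈ P.region v) :
    M.best - M.mean y ≤ 4 * (ν₁ * ρ ^ v.1) := by
  obtain ⟨x, hx, hle⟩ := h
  have hb : 0 < ν₁ * ρ ^ v.1 := by positivity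
  have h1 := hA.gap_le hν₁ hρ₀ hM hv hx hy
  have h2 : max (M.best - M.mean x) (ν₁ * ρ ^ v.1) ≤ 2 * (ν₁ * ρ ^ v.1) :=
    max_le hle (by linarith)
  linarith

/-- Descend from the root, which is near-optimal, until near-optimality is lost or depth `K` is
reached; either outcome passes to descendants. At the first node `v` that is not near-optimal the
gaps are still bounded through its parent, whence the division by `ρ`. -/
theorem gap_trichotomy [Nonempty X] (hA : ShrinkingRegions l ν₁ ρ ν₂ P) (hν₁ : 0 < ν₁)
    (hρ₀ : 0 < ρ) (hM : M.IsWeaklyLipschitz l) (K : ℕ) {w : Node}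
    (hw : IsDescendant root w) :
    (∀ x ∈ P.region w, M.best - M.mean x ≤ 4 * (ν₁ * ρ ^ K)) ∨
    (w.1 < K ∧ IsNearOptimal ν₁ ρ P M w) ∨
    ∃ v : Node, v.IsValid ∧ v.1 ≤ K ∧ ¬ IsNearOptimal ν₁ ρ P M v ∧ IsDescendant v w ∧
      ∀ x ∈ P.region w, M.best - M.mean x ≤ 4 * (ν₁ * ρ ^ v.1) / ρ := by
  have hchild : ∀ w c : Node, w.IsValid → c.IsValid → c.1 = w.1 + 1 →
      P.region c ⊆ P.region w → (∀ v, IsDescendant v w → IsDescendant v c) →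
      ((∀ x ∈ P.region w, M.best - M.mean x ≤ 4 * (ν₁ * ρ ^ K)) ∨
      (w.1 < K ∧ IsNearOptimal ν₁ ρ P M w) ∨
      ∃ v : Node, v.IsValid ∧ v.1 ≤ K ∧ ¬ IsNearOptimal ν₁ ρ P M v ∧ IsDescendant v w ∧
        ∀ x ∈ P.region w, M.best - M.mean x ≤ 4 * (ν₁ * ρ ^ v.1) / ρ) →
      (∀ x ∈ P.region c, M.best - M.mean x ≤ 4 * (ν₁ * ρ ^ K)) ∨
      (c.1 < K ∧ IsNearOptimal ν₁ ρ P M c) ∨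
      ∃ v : Node, v.IsValid ∧ v.1 ≤ K ∧ ¬ IsNearOptimal ν₁ ρ P M v ∧ IsDescendant v c ∧
        ∀ x ∈ P.region c, M.best - M.mean x ≤ 4 * (ν₁ * ρ ^ v.1) / ρ := by
    intro w c hw hc hdepth hsub hdesc h
    rcases h with h | ⟨hK, hI⟩ | ⟨v, h1, h2, h3, h4, h5⟩
    · exact Or.inl fun x hx => h x (hsub hx)
    · by_cases hcI : IsNearOptimal ν₁ ρ P M c
      · rcases Nat.lt_or_ge c.1 K with hlt | hge
        · exact Or.inr (Or.inl ⟨hlt, hcI⟩)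
        · refine Or.inl fun x hx => ?_
          rw [show K = c.1 by omega]
          exact hcI.gap_le hA hν₁ hρ₀ hM hc hx
      · refine Or.inr (Or.inr ⟨c, hc, by omega, hcI, .refl, fun x hx => ?_⟩)
        have h1 := hI.gap_le hA hν₁ hρ₀ hM hw (hsub hx)
        have h2 : 4 * (ν₁ * ρ ^ c.1) / ρ = 4 * (ν₁ * ρ ^ w.1) := by
          rw [hdepth, pow_succ]
          field_simp
        rwa [h2]
    · exact Or.inr (Or.inr ⟨v, h1, h2, h3, hdesc v h4, fun x hx => h5 x (hsub hx)⟩)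
  induction hw with
  | refl =>
    have hI : IsNearOptimal ν₁ ρ P M root := by
      obtain ⟨x, hx, hlt⟩ := (isOptimal_root P M).2 (2 * (ν₁ * ρ ^ root.1)) (by positivity)
      exact ⟨x, hx, hlt.le⟩
    rcases Nat.eq_zero_or_pos K with rfl | hK
    · exact Or.inl fun x hx => hI.gap_le hA hν₁ hρ₀ hM root_isValid hx
    · exact Or.inr (Or.inl ⟨hK, hI⟩)
  | left w hw ih =>
    have hwv := (P.region_subset_aux root_isValid hw).1
    exact hchild w _ hwv hwv.leftChild rfl (P.region_subset hwv (.left w .refl))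
      (fun v hv => .left w hv) ih
  | right w hw ih =>
    have hwv := (P.region_subset_aux root_isValid hw).1
    exact hchild w _ hwv hwv.rightChild rfl (P.region_subset hwv (.right w .refl))
      (fun v hv => .right w hv) ih

/-- The nodes of depth at most `K`. -/
def nodesUpTo (K : ℕ) : Finset (Σ _ : ℕ, ℕ) :=
  (Finset.range (K + 1)).sigma fun h => Finset.Icc 1 (2 ^ h)

theorem mem_nodesUpTo {K : ℕ} {v : Node} (hv : v.IsValid) (hK : v.1 ≤ K) :
    (⟨v.1, v.2⟩ : Σ _ : ℕ, ℕ) ∈ nodesUpTo K := by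
  simp only [nodesUpTo, Finset.mem_sigma, Finset.mem_range, Finset.mem_Icc]
  exact ⟨by omega, hv⟩

open Classical in
theorem IsRegular.gap_le_sum [Nonempty X] (hA : ShrinkingRegions l ν₁ ρ ν₂ P) (hν₁ : 0 < ν₁)
    (hρ₀ : 0 < ρ) (hρ₁ : ρ < 1) (hM : M.IsWeaklyLipschitz l) (K : ℕ) {n : ℕ} {H : History X n}
    (hH : IsRegular P H) (t : Fin n) :
    M.best - M.mean (H t).2.1 ≤ 4 * (ν₁ * ρ ^ K) +
      ∑ p ∈ nodesUpTo K, 4 * (ν₁ * ρ ^ p.1) / ρ * ((if (H t).1 = (p.1, p.2) then 1 else 0) +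
        if ¬ IsNearOptimal ν₁ ρ P M (p.1, p.2) then
          (if IsDescendant (p.1, p.2) (H t).1 then 1 else 0) else 0) := by
  set g : (Σ _ : ℕ, ℕ) → ℝ := fun p =>
    4 * (ν₁ * ρ ^ p.1) / ρ * ((if (H t).1 = (p.1, p.2) then 1 else 0) +
        if ¬ IsNearOptimal ν₁ ρ P M (p.1, p.2) then
          (if IsDescendant (p.1, p.2) (H t).1 then 1 else 0) else 0) with hg
  have hg0 : ∀ p, 0 ≤ g p := fun p => by
    simp only [hg]
    refine mul_nonneg (by positivity) (add_nonneg ?_ ?_) <;> split_ifs <;> norm_num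
  have hsum0 : 0 ≤ ∑ p ∈ nodesUpTo K, g p := Finset.sum_nonneg fun p _ => hg0 p
  have hK0 : 0 < ν₁ * ρ ^ K := by positivity
  have hx := hH.mem_region t
  rcases gap_trichotomy hA hν₁ hρ₀ hM K (hH.isDescendant_root t) with
    h | ⟨hK, hI⟩ | ⟨v, h1, h2, h3, h4, h5⟩
  · linarith [h _ hx]
  · have h1 := hI.gap_le hA hν₁ hρ₀ hM (hH.isValid t) hx
    have h2 := Finset.single_le_sum (fun p _ => hg0 p) (mem_nodesUpTo (hH.isValid t) hK.le)
    have h3 : 4 * (ν₁ * ρ ^ (H t).1.1) ≤ g ⟨(H t).1.1, (H t).1.2⟩ := by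
      have hpos : 0 ≤ 4 * (ν₁ * ρ ^ (H t).1.1) := by positivity
      simp only [hg, Prod.mk.eta, if_true]
      calc 4 * (ν₁ * ρ ^ (H t).1.1) ≤ 4 * (ν₁ * ρ ^ (H t).1.1) / ρ :=
            le_div_self hpos hρ₀ hρ₁.le
        _ ≤ _ := le_mul_of_one_le_right (by positivity) (le_add_of_nonneg_right (by
            split_ifs <;> norm_num))
    linarith
  · have h6 := Finset.single_le_sum (fun p _ => hg0 p) (mem_nodesUpTo h1 h2)
    have h7 : 4 * (ν₁ * ρ ^ v.1) / ρ ≤ g ⟨v.1, v.2⟩ := by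
      simp only [hg, Prod.mk.eta, h3, h4, if_true, not_false_eq_true]
      exact le_mul_of_one_le_right (by positivity) (le_add_of_nonneg_left (by
        split_ifs <;> norm_num))
    linarith [h5 _ hx]

open Classical in
-- Exchanging the sums over rounds and nodes, the `1` appears because no node is played twice, and
-- the rounds below `v` add up to its visit count.
theorem IsRegular.regret_le [Nonempty X] (hA : ShrinkingRegions l ν₁ ρ ν₂ P) (hν₁ : 0 < ν₁)
    (hρ₀ : 0 < ρ) (hρ₁ : ρ < 1) (hM : M.IsWeaklyLipschitz l) (K : ℕ) {n : ℕ} {H : History X n}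
    (hH : IsRegular P H) :
    regret M H ≤ n * (4 * (ν₁ * ρ ^ K)) +
      ∑ p ∈ nodesUpTo K, 4 * (ν₁ * ρ ^ p.1) / ρ *
        (1 + if ¬ IsNearOptimal ν₁ ρ P M (p.1, p.2) then
          (visitCount H (p.1, p.2) : ℝ) else 0) := by
  have h1 : regret M H = ∑ t, (M.best - M.mean (H t).2.1) := by
    simp [regret]
  rw [h1]
  refine (Finset.sum_le_sum fun t _ => hH.gap_le_sum hA hν₁ hρ₀ hρ₁ hM K t).trans ?_
  rw [Finset.sum_add_distrib, Finset.sum_const, Finset.card_univ, Fintype.card_fin, nsmul_eq_mul,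
    Finset.sum_comm]
  refine add_le_add_right (Finset.sum_le_sum fun p _ => ?_) _
  rw [← Finset.mul_sum, Finset.sum_add_distrib]
  refine mul_le_mul_of_nonneg_left (add_le_add ?_ ?_) (by positivity)
  · rw [Finset.sum_boole]
    exact_mod_cast Finset.card_le_one.mpr fun s hs t ht =>
      hH.injective (by simp only [Finset.mem_filter] at hs ht; exact hs.2.trans ht.2.symm)
  · split_ifs
    · simp
    · rw [visitCount_eq_sum]
      push_cast
      rfl

theorem regret_nonneg (M : Environment X) {n : ℕ} (H : History X n) : 0 ≤ regret M H := by
  have h1 : regret M H = ∑ t, (M.best - M.mean (H t).2.1) := by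
    simp [regret]
  rw [h1]
  exact Finset.sum_nonneg fun t _ => sub_nonneg.mpr (M.mean_le_best _)

theorem Strategy.IsHOO.expectedRegret_le [Nonempty X] (hφ : φ.IsHOO ν₁ ρ P)
    (hA : ShrinkingRegions l ν₁ ρ ν₂ P) (hν₁ : 0 < ν₁) (hρ₀ : 0 < ρ) (hρ₁ : ρ < 1)
    (hM : M.IsWeaklyLipschitz l) (K : ℕ) {n : ℕ} (hn : 1 ≤ n) :
    expectedRegret φ M n ≤ n * (4 * (ν₁ * ρ ^ K)) +
      ∑ h ∈ Finset.range (K + 1), 2 ^ h * (4 * (ν₁ * ρ ^ h) / ρ *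
        (10 + 8 * Real.log n / (ν₁ * ρ ^ h) ^ 2)) := by
  classical
  have hlogn : 0 ≤ Real.log n := Real.log_nonneg (by exact_mod_cast hn)
  have hint : ∀ v : Node, Integrable (fun H : History X n => (visitCount H v : ℝ))
      (law φ M n) := by
    intro v
    refine Integrable.of_bound (C := n)
      (measurable_from_top.comp (measurable_visitCount v)).aestronglyMeasurable
      (Eventually.of_forall fun H => ?_)
    rw [Real.norm_natCast]
    exact_mod_cast visitCount_le H v
  have hint' : ∀ p ∈ nodesUpTo K, Integrable (fun H : History X n =>
      4 * (ν₁ * ρ ^ p.1) / ρ * (1 + if ¬ IsNearOptimal ν₁ ρ P M (p.1, p.2) then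
          (visitCount H (p.1, p.2) : ℝ) else 0)) (law φ M n) := by
    intro p _
    refine Integrable.const_mul ((integrable_const 1).add ?_) _
    split_ifs
    · exact integrable_const 0
    · exact hint _
  calc expectedRegret φ M n
      ≤ ∫ H, (n * (4 * (ν₁ * ρ ^ K)) + ∑ p ∈ nodesUpTo K, 4 * (ν₁ * ρ ^ p.1) / ρ *
        (1 + if ¬ IsNearOptimal ν₁ ρ P M (p.1, p.2) then
          (visitCount H (p.1, p.2) : ℝ) else 0)) ∂(law φ M n) := by
        refine integral_mono_of_nonneg (Eventually.of_forall fun H => regret_nonneg M H)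
          ((integrable_const _).add (integrable_finsetSum _ hint')) ?_
        filter_upwards [hφ.ae_isRegular M n] with H hH
        exact hH.regret_le hA hν₁ hρ₀ hρ₁ hM K
    _ = n * (4 * (ν₁ * ρ ^ K)) + ∑ p ∈ nodesUpTo K, ∫ H, 4 * (ν₁ * ρ ^ p.1) / ρ *
        (1 + if ¬ IsNearOptimal ν₁ ρ P M (p.1, p.2) then
          (visitCount H (p.1, p.2) : ℝ) else 0) ∂(law φ M n) := by
        rw [integral_add (integrable_const _) (integrable_finsetSum _ hint'),
          integral_finsetSum _ hint', integral_const, probReal_univ, one_smul]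
    _ ≤ n * (4 * (ν₁ * ρ ^ K)) + ∑ p ∈ nodesUpTo K, 4 * (ν₁ * ρ ^ p.1) / ρ *
        (10 + 8 * Real.log n / (ν₁ * ρ ^ p.1) ^ 2) := by
        refine add_le_add_right (Finset.sum_le_sum fun p hp => ?_) _
        rw [integral_const_mul]
        refine mul_le_mul_of_nonneg_left ?_ (by positivity)
        have hpos : 0 ≤ 8 * Real.log n / (ν₁ * ρ ^ p.1) ^ 2 := by positivity
        by_cases hI : IsNearOptimal ν₁ ρ P M (p.1, p.2)
        · simp only [hI, not_true_eq_false, if_false, add_zero, integral_const, probReal_univ,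
            one_smul]
          linarith
        · simp only [hI, not_false_eq_true, if_true]
          rw [integral_add (integrable_const _) (hint _), integral_const, probReal_univ, one_smul]
          simp only [nodesUpTo, Finset.mem_sigma, Finset.mem_Icc] at hp
          have := hφ.integral_visitCount_le (M := M) hA hν₁ hρ₀ hM (v := (p.1, p.2)) hp.2
            (fun x hx => by
              by_contra! hlt
              exact hI ⟨x, hx, hlt.le⟩) hn
          linarith
    _ = _ := by
        rw [nodesUpTo, Finset.sum_sigma]
        congr 1
        refine Finset.sum_congr rfl fun h _ => ?_
        simp only [Finset.sum_const, Nat.card_Icc, Nat.add_sub_cancel, nsmul_eq_mul]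
        push_cast
        rfl

end RegretBound

/-! ### Choice of the depth -/

section Rate

/-- Balancing the two terms of the regret bound by the choice of the depth. -/
theorem exists_depth_balance {ν₁ ρ D' : ℝ} (hν₁ : 0 < ν₁) (hρ₀ : 0 < ρ) (hρ₁ : ρ < 1)
    (hD' : 0 < D') (hdim : 2 ≤ ρ ^ (-D')) {n : ℕ} (hn : 2 ≤ n) :
    ∃ K : ℕ, n * (4 * (ν₁ * ρ ^ K)) +
      ∑ h ∈ Finset.range (K + 1), 2 ^ h * (4 * (ν₁ * ρ ^ h) / ρ *
        (10 + 8 * Real.log n / (ν₁ * ρ ^ h) ^ 2))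
      ≤ (4 * ν₁ + 4 * ν₁ / ρ * (15 + 8 / ν₁ ^ 2) *
          ((ρ ^ (-(D' + 1))) ^ 2 / (ρ ^ (-(D' + 1)) - 1)))
        * (n : ℝ) ^ ((D' + 1) / (D' + 2)) * Real.log n ^ (1 / (D' + 2)) := by
  have hn2 : (2 : ℝ) ≤ n := by exact_mod_cast hn
  have hn0 : (0 : ℝ) < n := by linarith
  -- Absorbs the additive constant into the logarithm: `10 ≤ 15 * log n`.
  have hlog2 : (2 : ℝ) / 3 ≤ Real.log n := by
    have := Real.log_le_log (by norm_num) hn2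
    linarith [Real.log_two_gt_d9]
  have hlog0 : 0 < Real.log n := by linarith
  set b := ρ ^ (-(D' + 1)) with hb
  have hb1 : 1 < b := Real.one_lt_rpow_of_pos_of_lt_one_of_neg hρ₀ hρ₁ (by linarith)
  set A := 4 * ν₁ / ρ * (15 + 8 / ν₁ ^ 2) with hAdef
  have hA0 : 0 < A := by positivity
  -- The scale at which `n * x = log n * x ^ (-(D' + 1))`. The depth `k + 1` is the first with `ρ ^
  -- (k + 1) < x`.
  set x := (Real.log n / n) ^ (1 / (D' + 2)) with hx
  have hx0 : 0 < x := by positivity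
  have hx1 : x ≤ 1 := Real.rpow_le_one (by positivity)
    ((div_le_one hn0).mpr ((Real.log_le_sub_one_of_pos hn0).trans (by linarith))) (by positivity)
  obtain ⟨k, hk1, hk2⟩ := exists_nat_pow_near_of_lt_one hx0 hx1 hρ₀ hρ₁
  have hterm : ∀ h : ℕ, 2 ^ h * (4 * (ν₁ * ρ ^ h) / ρ *
        (10 + 8 * Real.log n / (ν₁ * ρ ^ h) ^ 2)) ≤ A * Real.log n * b ^ h := by
    intro h
    have hp0 : 0 < ρ ^ h := by positivity
    have hp1 : ρ ^ h ≤ 1 := pow_le_one₀ hρ₀.le hρ₁.le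
    have h1 : b ^ h = (ρ ^ (-D')) ^ h * (ρ ^ h)⁻¹ := by
      rw [← inv_pow, ← mul_pow, hb, neg_add, Real.rpow_add hρ₀, Real.rpow_neg_one]
    have h2 : (2 : ℝ) ^ h ≤ (ρ ^ (-D')) ^ h := pow_le_pow_left₀ (by norm_num) hdim h
    have h3 : 4 * (ν₁ * ρ ^ h) / ρ * (10 + 8 * Real.log n / (ν₁ * ρ ^ h) ^ 2)
        ≤ A * Real.log n * (ρ ^ h)⁻¹ := by
      have h4 : 10 * (ρ ^ h) ^ 2 ≤ 15 * Real.log n := by nlinarith [pow_le_one₀ hp0.le hp1 (n := 2)]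
      have h5 : 4 * (ν₁ * ρ ^ h) / ρ * (10 + 8 * Real.log n / (ν₁ * ρ ^ h) ^ 2)
          = 4 * ν₁ / ρ * (10 * (ρ ^ h) ^ 2 + 8 / ν₁ ^ 2 * Real.log n) * (ρ ^ h)⁻¹ := by
        field_simp
      have h6 : A * Real.log n * (ρ ^ h)⁻¹
          = 4 * ν₁ / ρ * (15 * Real.log n + 8 / ν₁ ^ 2 * Real.log n) * (ρ ^ h)⁻¹ := by
        rw [hAdef]; ring
      rw [h5, h6]
      gcongr
    calc _ ≤ (ρ ^ (-D')) ^ h * (A * Real.log n * (ρ ^ h)⁻¹) :=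
          mul_le_mul h2 h3 (by positivity) (by positivity)
      _ = A * Real.log n * b ^ h := by rw [h1]; ring
  -- The ratio `b` exceeds `1`, so the deepest level dominates.
  have hgeom : ∑ h ∈ Finset.range (k + 1 + 1), b ^ h ≤ b ^ (k + 1) * (b / (b - 1)) := by
    rw [geom_sum_eq hb1.ne', ← mul_div_assoc, ← pow_succ]
    exact div_le_div_of_nonneg_right (by linarith) (by linarith)
  have hbk : b ^ (k + 1) ≤ b * x ^ (-(D' + 1)) := by
    rw [hb, ← Real.mul_rpow hρ₀.le hx0.le, ← Real.rpow_natCast, ← Real.rpow_mul hρ₀.le, mul_comm,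
      Real.rpow_mul hρ₀.le, Real.rpow_natCast]
    refine Real.rpow_le_rpow_of_nonpos (by positivity) ?_ (by linarith)
    rw [pow_succ, mul_comm]
    exact mul_le_mul_of_nonneg_right hk2 hρ₀.le
  have hlogx : Real.log n * x ^ (-(D' + 1)) = n * x := by
    have h1 : x ^ (D' + 2) = Real.log n / n := by
      rw [hx, ← Real.rpow_mul (by positivity), one_div_mul_cancel (by linarith), Real.rpow_one]
    have h2 : Real.log n = n * x ^ (D' + 2) := by
      rw [h1]; field_simp
    rw [h2, mul_assoc, ← Real.rpow_add hx0, show D' + 2 + -(D' + 1) = 1 by ring, Real.rpow_one]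
  have hnx : (n : ℝ) ^ ((D' + 1) / (D' + 2)) * Real.log n ^ (1 / (D' + 2)) = n * x := by
    rw [hx, Real.div_rpow hlog0.le hn0.le]
    have h1 : (D' + 1) / (D' + 2) = 1 - 1 / (D' + 2) := by field_simp; ring
    rw [h1, Real.rpow_sub hn0, Real.rpow_one]
    ring
  refine ⟨k + 1, ?_⟩
  rw [mul_assoc, hnx]
  calc _ ≤ n * (4 * (ν₁ * x)) + ∑ h ∈ Finset.range (k + 1 + 1), A * Real.log n * b ^ h := by
        refine add_le_add ?_ (Finset.sum_le_sum fun h _ => hterm h)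
        gcongr
    _ ≤ n * (4 * (ν₁ * x)) + A * Real.log n * (b * x ^ (-(D' + 1)) * (b / (b - 1))) := by
        rw [← Finset.mul_sum]
        have : 0 < b - 1 := by linarith
        gcongr
        exact hgeom.trans (mul_le_mul_of_nonneg_right hbk (by positivity))
    _ = n * (4 * (ν₁ * x)) + A * (b ^ 2 / (b - 1)) * (Real.log n * x ^ (-(D' + 1))) := by ring
    _ = _ := by rw [hlogx]; ring

end Rate

end XArmedBandit

theorem theorem5 {X : Type*} [MeasurableSpace X] (l : XArmedBandit.Dissimilarity X)
    (D : ℝ) (hD : XArmedBandit.packingDimension l Set.univ = (D : EReal))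
    (ν₁ ρ ν₂ : ℝ) (hν₁ : 0 < ν₁) (hρ₀ : 0 < ρ) (hρ₁ : ρ < 1) (hν₂ : 0 < ν₂)
    (D' : ℝ) (hD' : D < D') :
    ∃ γ : ℝ, ∀ P : XArmedBandit.TreeOfCoverings X,
      XArmedBandit.ShrinkingRegions l ν₁ ρ ν₂ P →
      ∀ φ : XArmedBandit.Strategy X, φ.IsHOO ν₁ ρ P →
      ∀ n : ℕ, 2 ≤ n →
        ⨆ M ∈ XArmedBandit.weaklyLipschitzEnvironments l,
            ((XArmedBandit.expectedRegret φ M n : ℝ) : EReal)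
          ≤ ((γ * (n : ℝ) ^ ((D' + 1) / (D' + 2)) * (Real.log n) ^ (1 / (D' + 2)) : ℝ) : EReal) := by
  refine ⟨4 * ν₁ + 4 * ν₁ / ρ * (15 + 8 / ν₁ ^ 2) *
    ((ρ ^ (-(D' + 1))) ^ 2 / (ρ ^ (-(D' + 1)) - 1)), fun P hA φ hφ n hn => ?_⟩
  -- A1 supplies a center for the root region.
  have hX : Nonempty X := ⟨hA.2.choose XArmedBandit.root⟩
  have hdim := hA.log_two_le hρ₀ hρ₁ hν₂ (D' := D') (by rw [hD]; exact_mod_cast hD')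
  have hlogρ : 0 < Real.log ρ⁻¹ := Real.log_pos ((one_lt_inv₀ hρ₀).mpr hρ₁)
  -- Positivity of `D'` comes from `log 2 > 0` in the dimension bound.
  have hD'0 : 0 < D' := by
    by_contra! h
    nlinarith [Real.log_pos one_lt_two]
  have htwo : 2 ≤ ρ ^ (-D') := by
    rw [← Real.log_le_log_iff two_pos (by positivity), Real.log_rpow hρ₀]
    rw [Real.log_inv] at hdim
    linarith
  refine iSup₂_le fun M hM => EReal.coe_le_coe_iff.mpr ?_
  obtain ⟨K, hK⟩ := XArmedBandit.exists_depth_balance hν₁ hρ₀ hρ₁ hD'0 htwo hn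
  exact (hφ.expectedRegret_le hA hν₁ hρ₀ hρ₁ hM K (by omega)).trans hK
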